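/- Let $q$ be a piecewise continuous real function on $[-1,1]$ (finitely many discontinuities, finite one-sided limits), let $-1=x_0<x_1<\dots<x_N=1$ be a mesh containing all discontinuities of $q$, and let $\bar q$ be constant on every mesh cell $(x_{i-1},x_i)$. Put $\|f\|_\infty=\sup_{[-1,1]}|f|$ and $\|f\|=\bigl(\int_{-1}^1 f^2\,dx\bigr)^{1/2}$. For a potential $p\in\{q,\bar q\}$ consider the singular eigenvalue problem $$\frac{d}{dx}\Bigl[(1-x^2)\frac{du}{dx}\Bigr]+(\lambda-p(x))u=0 \text{ on } (-1,1),\qquad \lim_{x\to\pm1}(1-x^2)u'(x)=0,$$ where $u$ is square integrable, $u$ and $u'$ are continuous on $(-1,1)$, and the equation holds off the mesh points. For each of the two potentials the eigenvalues form a strictly increasing infinite sequence; write $\lambda^{(0)}_0<\lambda^{(0)}_1<\dots$ for $p=\bar q$ (the basic problem) and $\lambda_0<\lambda_1<\dots$ for $p=q$. Let $M_0=(\lambda^{(0)}_1-\lambda^{(0)}_0)^{-1}$, $M_n=\max\{(\lambda^{(0)}_n-\lambda^{(0)}_{n-1})^{-1},(\lambda^{(0)}_{n+1}-\lambda^{(0)}_n)^{-1}\}$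 for $n\ge1$, $\bar r_n=M_n\|q-\bar q\|_\infty$, $r_n=4\bar r_n$, and $\alpha_j=2\frac{(2j-1)!!}{(2j+2)!!}$ with $(-1)!!=1$. Fix $n\ge 0$ with $\bar r_n\le\frac14$. Let $u^{(0)}_n$ be an eigenfunction of the basic problem for $\lambda^{(0)}_n$ with $\|u_n^{(0)}\|=1$. The FD-method determines, successively for $j=1,2,\dots$, numbers $\lambda^{(j)}_n$ and square integrable functions $u^{(j)}_n$ such that $u^{(j)}_n$ and $(u_n^{(j)})'$ are continuous on $(-1,1)$ and $$\frac{d}{dx}\Bigl[(1-x^2)\frac{du^{(j)}_n}{dx}\Bigr]+(\lambda^{(0)}_n-\bar q)u^{(j)}_n=-\sum_{s=0}^{j-1}\lambda^{(j-s)}_nu^{(s)}_n+(q-\bar q)u^{(j-1)}_n \quad\text{off the mesh points},$$ $$\lim_{x\to\pm1}(1-x^2)(u_n^{(j)})'(x)=0,\qquad \int_{-1}^1u^{(j)}_nu^{(0)}_n\,dx=0 .$$ Such corrections exist. The $n$-th eigenvalue $\lambda_n$ of the problem with potential $q$ has an eigenfunction $u_n$ with $\int_{-1}^1u_nu^{(0)}_n\,dx=1$,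 and for it the FD-method converges superexponentially, that is, faster than the geometric series with ratio $r_n$: as $m\to\infty$, $$\Bigl\|u_n-\sum_{j=0}^mu^{(j)}_n\Bigr\|=o(r_n^m),\qquad \Bigl|\lambda_n-\sum_{j=0}^m\lambda^{(j)}_n\Bigr|=o(r_n^m).$$ If $r_n<1$, then for all $m\ge0$ $$\Bigl\|u_n-\sum_{j=0}^mu^{(j)}_n\Bigr\|\le\frac{r_n^{m+1}}{1-r_n}\alpha_{m+1},\qquad \Bigl|\lambda_n-\sum_{j=0}^m\lambda^{(j)}_n\Bigr|\le\|q-\bar q\|_\infty\frac{r_n^m}{1-r_n}\alpha_m .$$ If $r_n=1$, then $$\Bigl\|u_n-\sum_{j=0}^mu^{(j)}_n\Bigr\|\le\sum_{j=m+1}^\infty\frac1{(j+1)\sqrt{\pi j}}\quad(m\ge0),\qquad \Bigl|\lambda_n-\sum_{j=0}^m\lambda^{(j)}_n\Bigr|\le\|q-\bar q\|_\infty\sum_{j=m}^\infty\frac1{(j+1)\sqrt{\pi j}}\quad(m\ge1).$$ -/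

import Mathlib

open Set Filter Topology MeasureTheory Asymptotics
open scoped Nat

/-- `q` is piecewise continuous on `[-1, 1]`: finitely many discontinuities, and all one-sided
limits exist and are finite. -/
def PiecewiseContinuous (q : ℝ → ℝ) : Prop :=
  {x ∈ Icc (-1 : ℝ) 1 | ¬ ContinuousWithinAt q (Icc (-1 : ℝ) 1) x}.Finite ∧
  (∀ x ∈ Ico (-1 : ℝ) 1, ∃ l : ℝ, Tendsto q (𝓝[>] x) (𝓝 l)) ∧
  (∀ x ∈ Ioc (-1 : ℝ) 1, ∃ l : ℝ, Tendsto q (𝓝[<] x) (𝓝 l))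

/-- `x` is a mesh `-1 = x 0 < x 1 < ... < x N = 1`. -/
structure IsMesh {N : ℕ} (x : Fin (N + 1) → ℝ) : Prop where
  strictMono : StrictMono x
  first : x 0 = -1
  last : x (Fin.last N) = 1

/-- `qbar` is constant on every mesh cell (its values at the mesh points themselves are free,
so any convention such as half-open cells is covered). -/
def IsPiecewiseConstant {N : ℕ} (x : Fin (N + 1) → ℝ) (qbar : ℝ → ℝ) : Prop :=
  ∀ i : Fin N, ∃ c : ℝ, ∀ y ∈ Ioo (x i.castSucc) (x i.succ), qbar y = c

/-- The supremum norm of `f` over `[-1, 1]`. -/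
noncomputable def supNorm (f : ℝ → ℝ) : ℝ := sSup ((fun x => |f x|) '' Icc (-1 : ℝ) 1)

/-- The norm of `L²(-1, 1)`. -/
noncomputable def l2Norm (f : ℝ → ℝ) : ℝ := Real.sqrt (∫ x in (-1 : ℝ)..1, f x ^ 2)

/-- `u` is a square integrable solution of `((1 - x²) u')' + (lam - p) u = F` on `(-1, 1)`
with `(1 - x²) u' → 0` at both ends. The function and its derivative are continuous on `(-1, 1)`
(no jumps at the points of `X`); the equation holds at every point outside the finite set `X`,
which is to contain the discontinuities of `p` and `F`. -/
structure SolvesBVP (X : Set ℝ) (p : ℝ → ℝ) (lam : ℝ) (F u : ℝ → ℝ) : Prop where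
  differentiable : ∀ x ∈ Ioo (-1 : ℝ) 1, DifferentiableAt ℝ u x
  continuous_deriv : ContinuousOn (deriv u) (Ioo (-1 : ℝ) 1)
  equation : ∀ x ∈ Ioo (-1 : ℝ) 1, x ∉ X →
    HasDerivAt (fun y => (1 - y ^ 2) * deriv u y) (F x - (lam - p x) * u x) x
  boundary_left : Tendsto (fun x => (1 - x ^ 2) * deriv u x) (𝓝[>] (-1)) (𝓝 0)
  boundary_right : Tendsto (fun x => (1 - x ^ 2) * deriv u x) (𝓝[<] 1) (𝓝 0)
  memLp : MemLp u 2 (volume.restrict (Ioo (-1 : ℝ) 1))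

/-- `u` is an eigenfunction, with eigenvalue `lam`, of the problem
`((1 - x²) u')' + (lam - p) u = 0`, `(1 - x²) u' → 0` at `±1`. -/
def IsEigenfunction (X : Set ℝ) (p : ℝ → ℝ) (lam : ℝ) (u : ℝ → ℝ) : Prop :=
  SolvesBVP X p lam (fun _ => 0) u ∧ ∃ x ∈ Ioo (-1 : ℝ) 1, u x ≠ 0

/-- `lam 0 < lam 1 < ...` are all the eigenvalues of the problem with potential `p`. -/
def IsEigenvalueSeq (X : Set ℝ) (p : ℝ → ℝ) (lam : ℕ → ℝ) : Prop :=
  StrictMono lam ∧ range lam = {l : ℝ | ∃ u : ℝ → ℝ, IsEigenfunction X p l u}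

/-- `M n`: the inverse of the distance from `lam n` to its nearest neighbour. -/
noncomputable def invGap (lam : ℕ → ℝ) : ℕ → ℝ
  | 0 => (lam 1 - lam 0)⁻¹
  | n + 1 => max (lam (n + 1) - lam n)⁻¹ (lam (n + 2) - lam (n + 1))⁻¹

/-- The right-hand side of the `j`-th recurrence problem. -/
noncomputable def fdRhs (q qbar : ℝ → ℝ) (mu : ℕ → ℝ) (v : ℕ → ℝ → ℝ) : ℕ → ℝ → ℝ
  | 0 => fun _ => 0
  | j + 1 => fun x =>
      -∑ s ∈ Finset.range (j + 1), mu (j + 1 - s) * v s x + (q x - qbar x) * v j x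

/-- `mu j` and `v j` are the corrections produced by the FD-method: `(mu 0, v 0)` is a normalized
eigenpair of the basic problem (potential `qbar`), the later ones solve the recurrence problems
and are orthogonal to `v 0`. -/
structure IsFDSeries (X : Set ℝ) (q qbar : ℝ → ℝ) (mu : ℕ → ℝ) (v : ℕ → ℝ → ℝ) : Prop where
  solves : ∀ j : ℕ, SolvesBVP X qbar (mu 0) (fdRhs q qbar mu v j) (v j)
  orthogonal : ∀ j : ℕ, ∫ x in (-1 : ℝ)..1, v j x * v 0 x = if j = 0 then 1 else 0

/-- `α j = 2 (2j - 1)!! / (2j + 2)!!`; for `j = 0` the truncated `2 * 0 - 1 = 0` gives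
`0‼ = 1`, in agreement with the convention `(-1)!! = 1`. -/
noncomputable def alphaFD (j : ℕ) : ℝ := 2 * ((2 * j - 1)‼ : ℝ) / ((2 * j + 2)‼ : ℝ)

/-- The tail `∑_{j ≥ m} 1 / ((j + 1) √(π j))`, used for `m ≥ 1`. -/
noncomputable def tailFD (m : ℕ) : ℝ :=
  ∑' k : ℕ, 1 / (((m + k : ℕ) + 1 : ℝ) * Real.sqrt (Real.pi * (m + k : ℕ)))

open scoped InnerProductSpace BoundedContinuousFunction

/-! Put `A u = -((1 - x²) u')'` on `L²(-1, 1)`, so that the problem reads `(A + p) u = lam u`.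
Adding the projection onto the constants to `A` removes the kernel, and the inverse `green` is
explicit: minus the flux `(1 - x²) u'` is the primitive of the source with its mean removed. By
Cauchy–Schwarz this primitive is `O(√(1 - x²))`, so `u'` is dominated by a multiple of `arcsin'`.
Arzelà–Ascoli then makes `green` compact, and Green's identity makes it symmetric and positive. A
Wronskian argument shows that eigenvalues are simple. Hence each problem has an orthonormal
eigenbasis with strictly increasing eigenvalues (`exists_isEigenbasis`), and the rest is
perturbation theory in a Hilbert space.

Let `D` be multiplication by `q - qbar`, of norm at most `eps`. Solvability of the correction
equations forces `mu (j + 1) = ⟪D (f j), f 0⟫`, and off the `n`-th eigenvector the resolvent has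
norm at most `M = invGap lam n`. Together these give `‖f (j + 1)‖ ≤ M eps ∑ ‖f s‖ ‖f (j - s)‖`,
which is the Catalan recursion, so `‖f j‖ ≤ (M eps) ^ j * catalan j = r ^ j * alphaFD j`
(`norm_le_catalan`, `catalan_eq_alphaFD`).

Since `∑ alphaFD j ≤ 2`, the series converge even for `r = 1`, and by the Cauchy product their sums
form an eigenpair for `q`. Its eigenvalue lies within `2 eps` of `lam0 n`, every eigenvalue moves by
at most `eps`, and the gaps at `lam0 n` are at least `4 eps`; so the index is still `n`
(`exists_hasSum`). All remainders are bounded by tails of `∑ r ^ j * alphaFD j`. Factoring out `r ^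
m` leaves a tail of a convergent series, whence `o(r ^ m)`; monotonicity of `alphaFD` gives the
bound for `r < 1`, and Wallis' product the one for `r = 1`. -/

/-- An infinite set of reals with finite initial segments is the range of a strictly increasing
sequence. -/
theorem exists_strictMono_range_eq {s : Set ℝ} (hinf : s.Infinite)
    (hfin : ∀ c, (s ∩ Iic c).Finite) : ∃ f : ℕ → ℝ, StrictMono f ∧ range f = s := by
  classical
  have hIcc : ∀ a b : s, (Icc a b).Finite := fun a b => by
    refine Finite.of_finite_image (f := Subtype.val) ((hfin b).subset ?_)
      Subtype.val_injective.injOn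
    rintro _ ⟨y, hy, rfl⟩
    exact ⟨y.2, hy.2⟩
  let _ : LocallyFiniteOrder s := LocallyFiniteOrder.ofFiniteIcc hIcc
  let _ : SuccOrder s := LinearLocallyFiniteOrder.succOrder s
  let _ : PredOrder s := LinearLocallyFiniteOrder.predOrder s
  obtain ⟨a, ha⟩ := hinf.nonempty
  obtain ⟨m, hm, hmin⟩ := exists_min_image (s ∩ Iic a) id (hfin a) ⟨a, ha, mem_Iic.2 le_rfl⟩
  let _ : OrderBot s :=
    { bot := ⟨m, hm.1⟩
      bot_le := fun y => by
        rcases le_total (y : ℝ) a with h | h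
        · exact hmin y ⟨y.2, h⟩
        · exact (hm.2.trans h : m ≤ y) }
  have : NoMaxOrder s := ⟨fun y => by
    by_contra! h
    refine hinf ((hfin y).subset fun z hz => ⟨hz, ?_⟩)
    exact h ⟨z, hz⟩⟩
  let e : s ≃o ℕ := orderIsoNatOfLinearSuccPredArch
  refine ⟨fun n => e.symm n, fun i j h => by simpa using h, ?_⟩
  ext y
  constructor
  · rintro ⟨n, rfl⟩
    exact (e.symm n).2
  · exact fun hy => ⟨e ⟨y, hy⟩, by simp⟩

/-! ### Spectral theory of `R⁻¹ + V` with `R` compact and positive -/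

section ResolventEquation

variable {H : Type*} [NormedAddCommGroup H] [InnerProductSpace ℝ H]

/-- The equation `(R⁻¹ + V - lam) u = g`, written without inverting `R`. -/
def ResolventEq (R V : H →L[ℝ] H) (lam : ℝ) (g u : H) : Prop := R (lam • u - V u + g) = u

/-- `R` is a compact, symmetric, nonnegative and injective operator. -/
structure IsCompactPositive (R : H →L[ℝ] H) : Prop where
  compact : IsCompactOperator R
  symm : ∀ x y, ⟪R x, y⟫_ℝ = ⟪x, R y⟫_ℝ
  nonneg : ∀ x, 0 ≤ ⟪R x, x⟫_ℝ
  injective : ∀ x, R x = 0 → x = 0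

variable {R V : H →L[ℝ] H} {lam mu : ℝ} {g h u w : H}

theorem ResolventEq.smul (c : ℝ) (hu : ResolventEq R V lam g u) :
    ResolventEq R V lam (c • g) (c • u) := by
  unfold ResolventEq at *
  conv_rhs => rw [← hu]
  rw [← map_smul]
  congr 1
  simp only [map_smul]
  module

/-- Symmetry of `R`, tested on the two sources, is Green's identity for `R⁻¹ + V`. It yields the
orthogonality of eigenvectors and the coordinates of any solution in an eigenbasis. -/
theorem ResolventEq.inner_eq (hR : ∀ x y, ⟪R x, y⟫_ℝ = ⟪x, R y⟫_ℝ)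
    (hV : ∀ x y, ⟪V x, y⟫_ℝ = ⟪x, V y⟫_ℝ)
    (hu : ResolventEq R V lam g u) (hw : ResolventEq R V mu h w) :
    (mu - lam) * ⟪u, w⟫_ℝ = ⟪g, w⟫_ℝ - ⟪u, h⟫_ℝ := by
  have key := hR (lam • u - V u + g) (mu • w - V w + h)
  rw [hu, hw] at key
  simp only [inner_add_left, inner_add_right, inner_sub_left, inner_sub_right, inner_smul_left,
    inner_smul_right, hV] at key
  simp only [RCLike.conj_to_real] at key
  linarith

/-- Nonnegativity of `R` on the source `lam • u - V u` says `lam ‖u‖² ≥ ⟪u, V u⟫`. -/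
theorem ResolventEq.neg_norm_le (hR : IsCompactPositive R) (hu : ResolventEq R V lam 0 u)
    (h0 : u ≠ 0) : -‖V‖ ≤ lam := by
  have h1 := hR.nonneg (lam • u - V u + 0)
  rw [hu] at h1
  simp only [add_zero, inner_sub_right, inner_smul_right, real_inner_self_eq_norm_sq] at h1
  have h2 : -(‖V‖ * ‖u‖ ^ 2) ≤ ⟪u, V u⟫_ℝ := by
    have := abs_real_inner_le_norm u (V u)
    have h3 := V.le_opNorm u
    have h4 := (abs_le.1 this).1
    nlinarith [norm_nonneg u]
  have h5 : 0 < ‖u‖ ^ 2 := by positivity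
  nlinarith

theorem norm_sub_sq_of_orthonormal {ι : Type*} {e : ι → H} (he : Orthonormal ℝ e) {i j : ι}
    (hij : i ≠ j) : ‖e i - e j‖ ^ 2 = 2 := by
  rw [norm_sub_sq_real, he.2 hij, he.1, he.1]; norm_num

theorem HilbertBasis.hasSum_inner_sq (b : HilbertBasis ℕ ℝ H) (x : H) :
    HasSum (fun k => ⟪x, b k⟫_ℝ ^ 2) (‖x‖ ^ 2) := by
  have := b.hasSum_inner_mul_inner x x
  rw [real_inner_self_eq_norm_sq] at this
  refine this.congr_fun fun k => ?_
  rw [real_inner_comm x (b k)]; ring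

theorem HilbertBasis.eq_zero_of_inner (b : HilbertBasis ℕ ℝ H) {x : H}
    (hx : ∀ k, ⟪x, b k⟫_ℝ = 0) : x = 0 := by
  have := b.hasSum_inner_sq x
  simp only [hx] at this
  have h0 : HasSum (fun _ : ℕ => (0 : ℝ) ^ 2) 0 := by simp
  simpa using this.unique h0

/-- Only finitely many eigenvalues lie below a given bound. -/
theorem finite_eigenvalues_le (hR : IsCompactPositive R)
    (hV : ∀ x y, ⟪V x, y⟫_ℝ = ⟪x, V y⟫_ℝ) (c : ℝ) :
    ({l | ∃ u, u ≠ 0 ∧ ResolventEq R V l 0 u} ∩ Iic c).Finite := by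
  by_contra hinf
  let f := Set.Infinite.natEmbedding _ hinf
  have hf : ∀ n, ∃ u, u ≠ 0 ∧ ResolventEq R V (f n : ℝ) 0 u := fun n => (f n).2.1
  choose v hv0 hv using hf
  set e : ℕ → H := fun n => ‖v n‖⁻¹ • v n with he
  have hen : ∀ n, ResolventEq R V (f n : ℝ) 0 (e n) := fun n => by
    simpa using (hv n).smul ‖v n‖⁻¹
  have hortho : Orthonormal ℝ e := by
    refine ⟨fun n => ?_, fun i j hij => ?_⟩
    · rw [he]; simp only [norm_smul, norm_inv, norm_norm]
      exact inv_mul_cancel₀ (norm_ne_zero_iff.2 (hv0 n))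
    · have := (hen i).inner_eq hR.symm hV (hen j)
      simp only [inner_zero_left, inner_zero_right, sub_self, mul_eq_zero] at this
      refine this.resolve_left (sub_ne_zero.2 fun h => hij ?_)
      exact (f.injective (Subtype.ext h)).symm
  -- The eigenvalues lie in `[-‖V‖, c]`, so the sources that `R` maps to the `e n` have norm at most
  -- `K`. Thus the `e n` lie in one compact set, although their mutual distances are all `√2`.
  set K := max |c| ‖V‖ + ‖V‖
  obtain ⟨C, hC, hsub⟩ := hR.compact.image_closedBall_subset_compact K
  have hmem : ∀ n, e n ∈ C := by
    intro n
    refine hsub ⟨(f n : ℝ) • e n - V (e n) + 0, ?_, hen n⟩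
    have hl : |(f n : ℝ)| ≤ max |c| ‖V‖ := by
      have h1 : (f n : ℝ) ≤ c := (f n).2.2
      have h2 := (hv n).neg_norm_le hR (hv0 n)
      rw [abs_le]
      constructor
      · linarith [le_max_right |c| ‖V‖]
      · linarith [le_max_left |c| ‖V‖, le_abs_self c]
    rw [mem_closedBall_zero_iff, add_zero]
    refine (norm_sub_le _ _).trans (add_le_add ?_ ?_)
    · rw [norm_smul, hortho.1, mul_one]; exact hl
    · simpa [hortho.1 n] using V.le_opNorm (e n)
  obtain ⟨y, -, ψ, hψ, hlim⟩ := hC.tendsto_subseq hmem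
  have hc := hlim.cauchySeq
  rw [Metric.cauchySeq_iff'] at hc
  obtain ⟨N, hN⟩ := hc 1 one_pos
  have h1 := hN (N + 1) (by lia)
  rw [dist_eq_norm] at h1
  have h2 := norm_sub_sq_of_orthonormal hortho (hψ.injective.ne (show N + 1 ≠ N by lia))
  simp only [Function.comp] at h1
  nlinarith [norm_nonneg (e (ψ (N + 1)) - e (ψ N))]

variable [CompleteSpace H]

/-- Fredholm alternative for the compact operator `-(R ∘L V)` at the value `1`. -/
theorem isUnit_one_add_comp (hR : IsCompactOperator R)
    (hinj : ∀ u, ResolventEq R V 0 0 u → u = 0) : IsUnit (1 + R ∘L V) := by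
  have hT : IsCompactOperator (-(R ∘L V)) := (hR.comp_clm V).neg
  rcases hT.hasEigenvalue_or_mem_resolventSet (one_ne_zero : (1 : ℝ) ≠ 0) with h | h
  · obtain ⟨u, hu⟩ := h.exists_hasEigenvector
    refine absurd (hinj u ?_) hu.2
    have := hu.apply_eq_smul
    simpa [ResolventEq] using this
  · rw [spectrum.mem_resolventSet_iff] at h
    simpa using h

theorem exists_resolventEq_of_injective (hR : IsCompactOperator R)
    (hinj : ∀ u, ResolventEq R V 0 0 u → u = 0) (g : H) : ∃ u, ResolventEq R V 0 g u := by
  have h := (ContinuousLinearMap.isUnit_iff_bijective.1 (isUnit_one_add_comp hR hinj)).2 (R g)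
  obtain ⟨u, hu⟩ := h
  refine ⟨u, ?_⟩
  have : u + R (V u) = R g := by simpa using hu
  simp [ResolventEq, ← this]

/-- The inverse of `R⁻¹ + V + (‖V‖ + 1)`. -/
theorem exists_shifted_inverse (hR : IsCompactPositive R)
    (hV : ∀ x y, ⟪V x, y⟫_ℝ = ⟪x, V y⟫_ℝ) :
    ∃ S : H →L[ℝ] H, IsCompactOperator S ∧ (∀ x y, ⟪S x, y⟫_ℝ = ⟪x, S y⟫_ℝ) ∧
      (∀ x, S x = 0 → x = 0) ∧ ∀ f, ResolventEq R V (-(‖V‖ + 1)) f (S f) := by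
  -- The shift puts `-s` strictly below `-‖V‖`, the lower bound for eigenvalues, so the shifted
  -- equation has no kernel.
  set s := ‖V‖ + 1 with hs
  set W : H →L[ℝ] H := V + s • 1 with hW
  have hWu : ∀ u, W u = V u + s • u := fun u => by simp [hW]
  have hinj : ∀ u, ResolventEq R W 0 0 u → u = 0 := by
    intro u hu
    by_contra h0
    have hu' : ResolventEq R V (-s) 0 u := by
      unfold ResolventEq at *
      rw [hWu] at hu
      convert hu using 2
      module
    have := hu'.neg_norm_le hR h0
    linarith
  have hunit := isUnit_one_add_comp hR.compact hinj
  obtain ⟨B, hB⟩ := hunit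
  have hBu : ∀ u, (1 + R ∘L W) ((↑B⁻¹ : H →L[ℝ] H) u) = u := fun u => by
    rw [← hB, ← mul_apply_eq_comp, B.mul_inv]; rfl
  have heq : ∀ f, ResolventEq R V (-s) f ((↑B⁻¹ : H →L[ℝ] H) (R f)) := by
    intro f
    have := hBu (R f)
    set u := (↑B⁻¹ : H →L[ℝ] H) (R f)
    have h2 : u + R (W u) = R f := by simpa using this
    have h3 : R f - R (W u) = u := by rw [← h2]; abel
    rw [← map_sub, hWu] at h3
    unfold ResolventEq
    convert h3 using 2
    module
  refine ⟨(↑B⁻¹ : H →L[ℝ] H) ∘L R, hR.compact.clm_comp _, fun x y => ?_, fun x hx => ?_, heq⟩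
  · have := (heq x).inner_eq hR.symm hV (heq y)
    simp only [sub_self, zero_mul] at this
    simp only [ContinuousLinearMap.comp_apply]
    linarith
  · have h := heq x
    simp only [ContinuousLinearMap.comp_apply] at hx
    rw [hx] at h
    exact hR.injective x (by simpa [ResolventEq] using h)

/-- The spectral theorem applies to the shifted inverse `S`: its eigenspaces have dense span, and
injectivity excludes the eigenvalue `0`. An eigenvalue `ν` of `S` corresponds to `ν⁻¹ - (‖V‖ + 1)`.
By simplicity one unit vector per eigenvalue suffices, and infinite dimension then forces infinitely
many eigenvalues. -/
theorem exists_hilbertBasis_eigenvectors (hR : IsCompactPositive R)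
    (hV : ∀ x y, ⟪V x, y⟫_ℝ = ⟪x, V y⟫_ℝ) (hdim : ¬ FiniteDimensional ℝ H)
    (hsimple : ∀ l u w, ResolventEq R V l 0 u → ResolventEq R V l 0 w → w ≠ 0 →
      ∃ c : ℝ, u = c • w) :
    ∃ (lam : ℕ → ℝ) (b : HilbertBasis ℕ ℝ H), StrictMono lam ∧
      ∀ k, ResolventEq R V (lam k) 0 (b k) := by
  obtain ⟨S, hSc, hSs, hSi, hS⟩ := exists_shifted_inverse hR hV
  set Λ : Set ℝ := {l | ∃ u, u ≠ 0 ∧ ResolventEq R V l 0 u} with hΛ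
  have hspec := ContinuousLinearMap.orthogonalComplement_iSup_eigenspaces_eq_bot hSc
    (fun x y => hSs x y)
  have hchoose : ∀ l : Λ, ∃ u : H, ‖u‖ = 1 ∧ ResolventEq R V l 0 u := by
    rintro ⟨l, u, hu0, hu⟩
    refine ⟨‖u‖⁻¹ • u, ?_, by simpa using hu.smul ‖u‖⁻¹⟩
    rw [norm_smul, norm_inv, norm_norm, inv_mul_cancel₀ (norm_ne_zero_iff.2 hu0)]
  choose E hE1 hE using hchoose
  have hspan : (⨆ ν, Module.End.eigenspace (S : Module.End ℝ H) ν) ≤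
      Submodule.span ℝ (range E) := by
    refine iSup_le fun ν x hx => ?_
    rw [Module.End.mem_eigenspace_iff] at hx
    have hx : S x = ν • x := hx
    rcases eq_or_ne x 0 with rfl | hx0
    · exact zero_mem _
    have hν : ν ≠ 0 := by
      rintro rfl
      exact hx0 (hSi x (by simpa using hx))
    have h1 := hS x
    have h2 : ResolventEq R V (ν⁻¹ - (‖V‖ + 1)) 0 x := by
      have h3 := h1.smul ν⁻¹
      rw [hx, smul_smul, inv_mul_cancel₀ hν, one_smul] at h3
      unfold ResolventEq at *
      convert h3 using 2
      module
    have hmem : (ν⁻¹ - (‖V‖ + 1)) ∈ Λ := ⟨x, hx0, h2⟩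
    have hne : E ⟨_, hmem⟩ ≠ 0 := by
      rw [← norm_ne_zero_iff, hE1]; exact one_ne_zero
    obtain ⟨c, hc⟩ := hsimple _ x _ h2 (hE ⟨_, hmem⟩) hne
    rw [hc]
    exact Submodule.smul_mem _ _ (Submodule.subset_span ⟨_, rfl⟩)
  have hbot : (Submodule.span ℝ (range E))ᗮ = ⊥ := by
    rw [eq_bot_iff, ← hspec]
    exact Submodule.orthogonal_le hspan
  have hinf : Λ.Infinite := by
    intro hfin
    have : Finite Λ := hfin
    have : FiniteDimensional ℝ (Submodule.span ℝ (range E)) :=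
      FiniteDimensional.span_of_finite ℝ (finite_range E)
    have htop : Submodule.span ℝ (range E) = ⊤ := by
      rwa [Submodule.orthogonal_eq_bot_iff] at hbot
    rw [htop] at this
    exact hdim (Module.Finite.equiv (Submodule.topEquiv (R := ℝ) (M := H)))
  obtain ⟨lam, hmono, hrange⟩ := exists_strictMono_range_eq hinf (finite_eigenvalues_le hR hV)
  have hmem : ∀ k, lam k ∈ Λ := fun k => hrange ▸ mem_range_self k
  let e : ℕ → H := fun k => E ⟨lam k, hmem k⟩
  have hortho : Orthonormal ℝ e := by
    refine ⟨fun n => hE1 _, fun i j hij => ?_⟩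
    have := (hE ⟨_, hmem i⟩).inner_eq hR.symm hV (hE ⟨_, hmem j⟩)
    simp only [inner_zero_left, inner_zero_right, sub_self, mul_eq_zero] at this
    exact this.resolve_left (sub_ne_zero.2 fun h => hij (hmono.injective h).symm)
  have hre : range e = range E := by
    ext y
    constructor
    · rintro ⟨k, rfl⟩; exact ⟨_, rfl⟩
    · rintro ⟨⟨l, hl⟩, rfl⟩
      rw [← hrange] at hl
      obtain ⟨k, rfl⟩ := hl
      exact ⟨k, rfl⟩
  refine ⟨lam, HilbertBasis.mkOfOrthogonalEqBot hortho (by rw [hre]; exact hbot), hmono,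
    fun k => ?_⟩
  rw [HilbertBasis.coe_mkOfOrthogonalEqBot]
  exact hE ⟨_, hmem k⟩

end ResolventEquation

/-! ### Spectral gaps, the numbers `α j` and the Cauchy product -/

theorem invGap_pos {lam : ℕ → ℝ} (h : StrictMono lam) (n : ℕ) : 0 < invGap lam n := by
  cases n with
  | zero => exact inv_pos.2 (sub_pos.2 (h one_pos))
  | succ n => exact lt_max_of_lt_left (inv_pos.2 (sub_pos.2 (h n.lt_succ_self)))

theorem one_le_invGap_mul {lam : ℕ → ℝ} (h : StrictMono lam) {n k : ℕ} (hk : k ≠ n) :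
    1 ≤ invGap lam n * |lam k - lam n| := by
  have key : ∀ {d x : ℝ}, 0 < d → d ≤ x → d⁻¹ ≤ invGap lam n → 1 ≤ invGap lam n * x := by
    intro d x hd hx hi
    calc (1 : ℝ) = d⁻¹ * d := (inv_mul_cancel₀ hd.ne').symm
      _ ≤ invGap lam n * x := mul_le_mul hi hx hd.le (invGap_pos h n).le
  rcases lt_or_gt_of_ne hk with hlt | hgt
  · obtain ⟨m, rfl⟩ : ∃ m, n = m + 1 := ⟨n - 1, by lia⟩
    refine key (sub_pos.2 (h m.lt_succ_self)) ?_ (le_max_left _ _)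
    rw [abs_sub_comm]
    exact (sub_le_sub_left (h.monotone (by lia)) _).trans (le_abs_self _)
  · refine key (d := lam (n + 1) - lam n) (sub_pos.2 (h n.lt_succ_self))
      ((sub_le_sub_right (h.monotone (by lia)) _).trans (le_abs_self _)) ?_
    cases n with
    | zero => exact le_rfl
    | succ n => exact le_max_right _ _

/-- Both sides start at `1` and have successive ratios `(2j + 1) / (2j + 4)`. The right-hand side is
the Catalan number divided by `4 ^ j`. -/
theorem alphaFD_eq (j : ℕ) : alphaFD j = (j.centralBinom : ℝ) / ((j + 1) * 4 ^ j) := by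
  induction j with
  | zero => simp [alphaFD]
  | succ j ih =>
    have h1 : alphaFD (j + 1) = alphaFD j * ((2 * j + 1) / (2 * j + 4)) := by
      have h2 : ((2 * (j + 1) - 1)‼ : ℝ) = (2 * j + 1) * ((2 * j - 1)‼ : ℝ) := by
        cases j with
        | zero => simp
        | succ j =>
          rw [show 2 * (j + 1 + 1) - 1 = (2 * (j + 1) - 1) + 2 by lia, Nat.doubleFactorial_add_two]
          push_cast [show 2 * (j + 1) - 1 + 2 = 2 * (j + 1) + 1 by lia]
          ring
      have h3 : ((2 * (j + 1) + 2)‼ : ℝ) = (2 * j + 4) * ((2 * j + 2)‼ : ℝ) := by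
        rw [show 2 * (j + 1) + 2 = (2 * j + 2) + 2 by lia, Nat.doubleFactorial_add_two]
        push_cast; ring
      have h4 : ((2 * j + 2)‼ : ℝ) ≠ 0 := by exact_mod_cast (Nat.doubleFactorial_pos _).ne'
      have h5 : (2 * (j : ℝ) + 4) ≠ 0 := by positivity
      rw [alphaFD, alphaFD, h2, h3]
      field_simp
    have h6 : ((j : ℝ) + 1) * ((j + 1).centralBinom : ℝ) = 2 * (2 * j + 1) * (j.centralBinom : ℝ) := by
      exact_mod_cast Nat.succ_mul_centralBinom_succ j
    have h7 : ((j + 1).centralBinom : ℝ) = 2 * (2 * j + 1) * (j.centralBinom : ℝ) / (j + 1) := by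
      rw [← h6]; field_simp
    rw [h1, ih, h7]
    push_cast
    have : (2 * (j : ℝ) + 4) ≠ 0 := by positivity
    field_simp
    ring

theorem catalan_eq_alphaFD (j : ℕ) : (catalan j : ℝ) = 4 ^ j * alphaFD j := by
  have h : ((j : ℝ) + 1) * catalan j = j.centralBinom := by
    exact_mod_cast succ_mul_catalan_eq_centralBinom j
  rw [alphaFD_eq, ← h]
  field_simp

theorem alphaFD_pos (j : ℕ) : 0 < alphaFD j := by
  rw [alphaFD_eq]
  have := j.centralBinom_pos
  positivity

theorem alphaFD_succ (j : ℕ) : alphaFD (j + 1) = alphaFD j * ((2 * j + 1) / (2 * j + 4)) := by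
  have h6 : ((j : ℝ) + 1) * ((j + 1).centralBinom : ℝ) = 2 * (2 * j + 1) * (j.centralBinom : ℝ) := by
    exact_mod_cast Nat.succ_mul_centralBinom_succ j
  have h7 : ((j + 1).centralBinom : ℝ) = 2 * (2 * j + 1) * (j.centralBinom : ℝ) / (j + 1) := by
    rw [← h6]; field_simp
  rw [alphaFD_eq, alphaFD_eq, h7]
  push_cast
  have : (2 * (j : ℝ) + 4) ≠ 0 := by positivity
  field_simp
  ring

theorem alphaFD_antitone : Antitone alphaFD := by
  refine antitone_nat_of_succ_le fun j => ?_
  rw [alphaFD_succ]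
  refine mul_le_of_le_one_right (alphaFD_pos j).le ?_
  rw [div_le_one (by positivity)]
  linarith

/-- A telescoping closed form. The resulting bound `2` is the value of the Catalan generating
function at its radius of convergence `1 / 4`. -/
theorem sum_range_alphaFD (m : ℕ) :
    ∑ j ∈ Finset.range m, alphaFD j = 2 - 2 * (m + 1) * alphaFD m := by
  induction m with
  | zero => simp [alphaFD]
  | succ m ih =>
    rw [Finset.sum_range_succ, ih, alphaFD_succ]
    push_cast
    have : (2 * (m : ℝ) + 4) ≠ 0 := by positivity
    field_simp
    ring

theorem sum_range_alphaFD_le (m : ℕ) : ∑ j ∈ Finset.range m, alphaFD j ≤ 2 := by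
  rw [sum_range_alphaFD]
  have := alphaFD_pos m
  have : 0 ≤ 2 * ((m : ℝ) + 1) * alphaFD m := by positivity
  linarith

theorem summable_alphaFD : Summable alphaFD :=
  summable_of_sum_range_le (fun j => (alphaFD_pos j).le) sum_range_alphaFD_le

/-- Turns the product of the summed eigenvalue and eigenvector series into the convolutions
occurring in the correction equations. -/
theorem HasSum.smul_cauchyProduct {E : Type*} [NormedAddCommGroup E] [NormedSpace ℝ E]
    [CompleteSpace E] {a : ℕ → ℝ} {f : ℕ → E} {s : ℝ} {t : E} (ha : HasSum a s) (hf : HasSum f t)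
    (ha' : Summable fun n => ‖a n‖) (hf' : Summable fun n => ‖f n‖) :
    HasSum (fun n => ∑ p ∈ Finset.HasAntidiagonal.antidiagonal n, a p.1 • f p.2) (s • t) := by
  have hs : Summable fun p : ℕ × ℕ => a p.1 • f p.2 := by
    refine Summable.of_norm ?_
    simp only [norm_smul]
    exact ha'.mul_of_nonneg hf' (fun _ => norm_nonneg _) (fun _ => norm_nonneg _)
  have h1 : HasSum (fun p : ℕ × ℕ => a p.1 • f p.2) (s • t) := ha.smul hf hs
  have h2 := (Finset.HasAntidiagonal.sigmaAntidiagonalEquivProd (A := ℕ)).hasSum_iff.2 h1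
  refine (h2.sigma fun n => ?_)
  have := hasSum_fintype fun p : Finset.HasAntidiagonal.antidiagonal n => a p.1.1 • f p.1.2
  rw [Finset.sum_coe_sort (Finset.HasAntidiagonal.antidiagonal n) (fun p => a p.1 • f p.2)] at this
  exact this

/-! ### Eigenbases: resolvent estimate, solvability, perturbation of eigenvalues -/

section Eigenbasis

variable {H : Type*} [NormedAddCommGroup H] [InnerProductSpace ℝ H]

/-- `b` consists of eigenvectors of `R⁻¹ + V`, whose eigenvalues `lam` increase strictly. -/
structure IsEigenbasis (R V : H →L[ℝ] H) (lam : ℕ → ℝ) (b : HilbertBasis ℕ ℝ H) : Prop where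
  symm_resolvent : ∀ x y, ⟪R x, y⟫_ℝ = ⟪x, R y⟫_ℝ
  symm_potential : ∀ x y, ⟪V x, y⟫_ℝ = ⟪x, V y⟫_ℝ
  strictMono : StrictMono lam
  eigen : ∀ k, ResolventEq R V (lam k) 0 (b k)

variable {R V D : H →L[ℝ] H} {lam lam' : ℕ → ℝ} {b b' : HilbertBasis ℕ ℝ H} {l : ℝ} {g u : H}

theorem HilbertBasis.inner_self_eq_one (b : HilbertBasis ℕ ℝ H) (n : ℕ) : ⟪b n, b n⟫_ℝ = 1 := by
  rw [real_inner_self_eq_norm_sq, b.orthonormal.1]; norm_num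

namespace IsEigenbasis

theorem inner_eq (hb : IsEigenbasis R V lam b) (hu : ResolventEq R V l g u) (k : ℕ) :
    (lam k - l) * ⟪u, b k⟫_ℝ = ⟪g, b k⟫_ℝ := by
  have := hu.inner_eq hb.symm_resolvent hb.symm_potential (hb.eigen k)
  simpa using this

theorem mem_range (hb : IsEigenbasis R V lam b) (hu : ResolventEq R V l 0 u) (h0 : u ≠ 0) :
    ∃ k, lam k = l := by
  by_contra! h
  refine h0 (b.eq_zero_of_inner fun k => ?_)
  have := hb.inner_eq hu k
  rw [inner_zero_left, mul_eq_zero] at this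
  exact this.resolve_left (sub_ne_zero.2 (h k))

theorem eq_smul (hb : IsEigenbasis R V lam b) {n : ℕ} (hu : ResolventEq R V (lam n) 0 u) :
    u = ⟪u, b n⟫_ℝ • b n := by
  rw [← sub_eq_zero]
  refine b.eq_zero_of_inner fun k => ?_
  rw [inner_sub_left, inner_smul_left, RCLike.conj_to_real]
  rcases eq_or_ne k n with rfl | hk
  · rw [b.inner_self_eq_one]; ring
  · have := hb.inner_eq hu k
    rw [inner_zero_left, mul_eq_zero] at this
    rw [this.resolve_left (sub_ne_zero.2 (hb.strictMono.injective.ne hk)),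
      b.orthonormal.2 (Ne.symm hk)]
    simp

/-- The resolvent estimate at an eigenvalue; only the component of the right-hand side off the
eigenvector counts. -/
theorem norm_le (hb : IsEigenbasis R V lam b) {n : ℕ} (hu : ResolventEq R V (lam n) g u)
    (hn : ⟪u, b n⟫_ℝ = 0) {g' : H} (hg : ∀ k, k ≠ n → ⟪g', b k⟫_ℝ = ⟪g, b k⟫_ℝ) :
    ‖u‖ ≤ invGap lam n * ‖g'‖ := by
  have hM := invGap_pos hb.strictMono n
  refine le_of_sq_le_sq ?_ (by positivity)
  rw [mul_pow]
  -- Parseval on both sides: the `k`-th coordinate of `u` is that of `g` divided by `lam k - lam n`.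
  refine hasSum_le (fun k => ?_) (b.hasSum_inner_sq u) ((b.hasSum_inner_sq g').mul_left _)
  rcases eq_or_ne k n with rfl | hk
  · rw [hn, zero_pow two_ne_zero]; positivity
  · have h1 := hb.inner_eq hu k
    have h2 := one_le_invGap_mul hb.strictMono hk
    rw [hg k hk, ← h1, mul_pow, ← mul_assoc, ← mul_pow, ← sq_abs (invGap lam n * _), abs_mul,
      abs_of_pos hM]
    exact le_mul_of_one_le_left (sq_nonneg _) (one_le_pow₀ h2)

/-- Solvability of the resolvent equation at an eigenvalue. -/
theorem exists_solution [CompleteSpace H] (hb : IsEigenbasis R V lam b) (hR : IsCompactOperator R)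
    {n : ℕ} (hg : ⟪g, b n⟫_ℝ = 0) :
    ∃ u, ResolventEq R V (lam n) g u ∧ ⟪u, b n⟫_ℝ = 0 := by
  -- Adding the projection onto `b n` removes the kernel, so Fredholm's alternative applies. Testing
  -- with `b n` gives `⟪u, b n⟫ = ⟪g, b n⟫ = 0`, so the added term vanishes on the solution.
  set W : H →L[ℝ] H := V - lam n • 1 + (innerSL ℝ (b n)).smulRight (b n) with hW
  have hiff : ∀ h u, ResolventEq R W 0 h u →
      ResolventEq R V (lam n) (h - ⟪b n, u⟫_ℝ • b n) u := by
    intro h u hu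
    unfold ResolventEq at *
    convert hu using 2
    simp [hW]
    module
  have hcoef : ∀ h u, ResolventEq R W 0 h u → ⟪u, b n⟫_ℝ = ⟪h, b n⟫_ℝ := by
    intro h u hu
    have := hb.inner_eq (hiff h u hu) n
    rw [sub_self, zero_mul, inner_sub_left, inner_smul_left, RCLike.conj_to_real,
      b.inner_self_eq_one] at this
    rw [real_inner_comm]
    linarith
  obtain ⟨u, hu⟩ := exists_resolventEq_of_injective hR (V := W) (fun u hu => by
    have h1 := hcoef 0 u hu
    rw [inner_zero_left] at h1
    have h2 := hiff 0 u hu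
    rw [real_inner_comm, h1, zero_smul, sub_zero] at h2
    rw [hb.eq_smul h2, h1, zero_smul]) g
  have h1 := (hcoef g u hu).trans hg
  have h2 := hiff g u hu
  rw [real_inner_comm, h1, zero_smul, sub_zero] at h2
  exact ⟨u, h2, h1⟩

/-- One half of the perturbation bound for eigenvalues, from a dimension count. -/
theorem eigenvalue_le (hb : IsEigenbasis R V lam b) (hb' : IsEigenbasis R (V + D) lam' b')
    {eps : ℝ} (hD : ∀ x, ⟪D x, x⟫_ℝ ≤ eps * ‖x‖ ^ 2) (m : ℕ) : lam' m ≤ lam m + eps := by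
  -- A nonzero kernel element is a combination `u` of `b 0, ..., b m` orthogonal to `b' 0, ..., b'
  -- (m - 1)`.
  let T : (Fin (m + 1) → ℝ) →ₗ[ℝ] (Fin m → ℝ) :=
    LinearMap.pi fun j => ∑ i : Fin (m + 1), ⟪b i, b' j⟫_ℝ • LinearMap.proj i
  have hker : LinearMap.ker T ≠ ⊥ := LinearMap.ker_ne_bot_of_finrank_lt (by simp)
  obtain ⟨c, hc, hc0⟩ := Submodule.exists_mem_ne_zero_of_ne_bot hker
  rw [LinearMap.mem_ker] at hc
  set u : H := ∑ i : Fin (m + 1), c i • b i with hu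
  -- The vector `a` plays the role of `(R⁻¹ + V) u`. The two orthogonality properties of `u` give
  -- `lam' m ‖u‖² ≤ ⟪a + D u, u⟫` and `⟪a, u⟫ ≤ lam m ‖u‖²`.
  set a : H := ∑ i : Fin (m + 1), (c i * lam i) • b i with ha
  have hRu : R (a - V u) = u := by
    rw [hu, ha, map_sum, ← Finset.sum_sub_distrib, map_sum]
    refine Finset.sum_congr rfl fun i _ => ?_
    have := (hb.eigen i).smul (c i)
    simp only [ResolventEq, smul_zero, add_zero] at this
    rw [mul_comm, mul_smul]
    exact this
  have hb_on : ∀ i j : Fin (m + 1), ⟪b i, b j⟫_ℝ = if i = j then 1 else 0 := by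
    intro i j
    rw [orthonormal_iff_ite.1 b.orthonormal]
    simp [Fin.ext_iff]
  have hnorm : ‖u‖ ^ 2 = ∑ i, c i ^ 2 := by
    rw [← real_inner_self_eq_norm_sq, hu, sum_inner]
    refine Finset.sum_congr rfl fun i _ => ?_
    simp [inner_sum, inner_smul_left, inner_smul_right, hb_on]
    ring
  have hau : ⟪a, u⟫_ℝ = ∑ i : Fin (m + 1), c i ^ 2 * lam i := by
    rw [ha, hu, sum_inner]
    refine Finset.sum_congr rfl fun i _ => ?_
    simp [inner_sum, inner_smul_left, inner_smul_right, hb_on]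
    ring
  have hpos : 0 < ‖u‖ ^ 2 := by
    rw [hnorm]
    obtain ⟨i, hi⟩ := Function.ne_iff.1 hc0
    exact Finset.sum_pos' (fun i _ => sq_nonneg _) ⟨i, Finset.mem_univ _, by
      have : c i ≠ 0 := hi
      positivity⟩
  have hau_le : ⟪a, u⟫_ℝ ≤ lam m * ‖u‖ ^ 2 := by
    rw [hau, hnorm, Finset.mul_sum]
    refine Finset.sum_le_sum fun i _ => ?_
    rw [mul_comm]
    exact mul_le_mul_of_nonneg_right (hb.strictMono.monotone (by lia)) (sq_nonneg _)
  have horth : ∀ j, j < m → ⟪u, b' j⟫_ℝ = 0 := by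
    intro j hj
    have := congrFun hc ⟨j, hj⟩
    simp only [T, LinearMap.pi_apply, LinearMap.sum_apply, LinearMap.smul_apply,
      LinearMap.proj_apply, smul_eq_mul, Pi.zero_apply] at this
    rw [hu, sum_inner, ← this]
    refine Finset.sum_congr rfl fun i _ => ?_
    rw [inner_smul_left, RCLike.conj_to_real]; ring
  have hsolve : ResolventEq R (V + D) 0 (a + D u) u := by
    unfold ResolventEq
    convert hRu using 2
    simp only [zero_smul, add_apply]
    abel
  have hsum := b'.hasSum_inner_mul_inner (a + D u) u
  have hge : lam' m * ‖u‖ ^ 2 ≤ ⟪a + D u, u⟫_ℝ := by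
    refine hasSum_le (fun k => ?_) ((b'.hasSum_inner_sq u).mul_left (lam' m)) hsum
    have h1 := hb'.inner_eq hsolve k
    rw [sub_zero] at h1
    rw [← h1, real_inner_comm u (b' k)]
    rcases lt_or_ge k m with hk | hk
    · rw [horth k hk]; simp
    · nlinarith [hb'.strictMono.monotone hk, sq_nonneg ⟪u, b' k⟫_ℝ]
  rw [inner_add_left] at hge
  nlinarith [hD u]

theorem abs_eigenvalue_sub_le (hb : IsEigenbasis R V lam b)
    (hb' : IsEigenbasis R (V + D) lam' b') {eps : ℝ} (hD : ∀ x, ‖D x‖ ≤ eps * ‖x‖) (m : ℕ) :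
    |lam' m - lam m| ≤ eps := by
  have habs : ∀ x, |⟪D x, x⟫_ℝ| ≤ eps * ‖x‖ ^ 2 := fun x => by
    refine (abs_real_inner_le_norm _ _).trans ?_
    nlinarith [hD x, norm_nonneg x]
  have h1 := hb.eigenvalue_le hb' (fun x => (le_abs_self _).trans (habs x)) m
  -- The reverse inequality exchanges the two operators and perturbs by `-D`.
  have hb2 : IsEigenbasis R (V + D + -D) lam b := by rwa [add_neg_cancel_right]
  have h2 := hb'.eigenvalue_le hb2 (fun x => by
    have := habs x
    rw [neg_apply, inner_neg_left]
    exact (neg_le_abs _).trans this) m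
  rw [abs_le]
  constructor <;> linarith

end IsEigenbasis

end Eigenbasis

/-! ### The perturbation series in a Hilbert space -/

section FDSequence

variable {H : Type*} [NormedAddCommGroup H] [InnerProductSpace ℝ H]

/-- The right-hand side of the `j`-th correction equation for a perturbation `D`. -/
def fdSource (D : H →L[ℝ] H) (mu : ℕ → ℝ) (f : ℕ → H) : ℕ → H
  | 0 => 0
  | j + 1 => ∑ s ∈ Finset.range (j + 1), mu (j + 1 - s) • f s - D (f j)

/-- The corrections `mu j`, `f j` of the perturbation series of `R⁻¹ + V` under `D`. -/
structure IsFDSequence (R V D : H →L[ℝ] H) (mu : ℕ → ℝ) (f : ℕ → H) : Prop where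
  solves : ∀ j, ResolventEq R V (mu 0) (fdSource D mu f j) (f j)
  orthogonal : ∀ j, ⟪f j, f 0⟫_ℝ = if j = 0 then 1 else 0

variable {R V D : H →L[ℝ] H} {lam lam' : ℕ → ℝ} {b b' : HilbertBasis ℕ ℝ H} {mu : ℕ → ℝ}
  {f : ℕ → H} {n : ℕ} {eps : ℝ}

namespace IsFDSequence

theorem norm_zero (hf : IsFDSequence R V D mu f) : ‖f 0‖ = 1 := by
  have := hf.orthogonal 0
  rw [if_pos rfl, real_inner_self_eq_norm_sq] at this
  exact (pow_eq_one_iff_of_nonneg (norm_nonneg _) two_ne_zero).1 this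

theorem inner_basis (hf : IsFDSequence R V D mu f) (hb : IsEigenbasis R V lam b)
    (hmu : mu 0 = lam n) : ∃ c : ℝ, c ≠ 0 ∧ f 0 = c • b n := by
  have h0 : ResolventEq R V (lam n) 0 (f 0) := hmu ▸ hf.solves 0
  refine ⟨⟪f 0, b n⟫_ℝ, fun h => ?_, hb.eq_smul h0⟩
  have h1 := hb.eq_smul h0
  rw [h, zero_smul] at h1
  have := hf.norm_zero
  simp [h1] at this

theorem inner_succ_basis (hf : IsFDSequence R V D mu f) (hb : IsEigenbasis R V lam b)
    (hmu : mu 0 = lam n) (j : ℕ) : ⟪f (j + 1), b n⟫_ℝ = 0 := by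
  obtain ⟨c, hc, h0⟩ := hf.inner_basis hb hmu
  have := hf.orthogonal (j + 1)
  rw [h0, inner_smul_right, if_neg j.succ_ne_zero] at this
  exact (mul_eq_zero.1 this).resolve_left hc

/-- This is the solvability condition: the source must be orthogonal to the kernel vector `f 0`, and
the orthogonality of the corrections leaves only the term `s = 0` of the sum. -/
theorem mu_succ (hf : IsFDSequence R V D mu f) (hb : IsEigenbasis R V lam b)
    (hmu : mu 0 = lam n) (j : ℕ) : mu (j + 1) = ⟪D (f j), f 0⟫_ℝ := by
  obtain ⟨c, hc, h0⟩ := hf.inner_basis hb hmu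
  have h1 := hb.inner_eq (hf.solves (j + 1)) n
  rw [hmu, sub_self, zero_mul] at h1
  have h2 : ⟪fdSource D mu f (j + 1), f 0⟫_ℝ = 0 := by
    rw [h0, inner_smul_right, ← h1, mul_zero]
  rw [fdSource, inner_sub_left, sum_inner, Finset.sum_eq_single 0] at h2
  · rw [inner_smul_left, hf.orthogonal, if_pos rfl] at h2
    simp only [Nat.sub_zero, RCLike.conj_to_real] at h2
    linarith
  · intro s _ hs
    rw [inner_smul_left, hf.orthogonal, if_neg hs, mul_zero]
  · simp

theorem abs_mu_succ_le (hf : IsFDSequence R V D mu f) (hb : IsEigenbasis R V lam b)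
    (hmu : mu 0 = lam n) (hD : ∀ x, ‖D x‖ ≤ eps * ‖x‖) (j : ℕ) :
    |mu (j + 1)| ≤ eps * ‖f j‖ := by
  rw [hf.mu_succ hb hmu]
  refine (abs_real_inner_le_norm _ _).trans ?_
  rw [hf.norm_zero, mul_one]
  exact hD _

/-- The term `mu (j + 1) • f 0` is parallel to the eigenvector and does not count in the resolvent
estimate. The other eigenvalue corrections satisfy `|mu (i + 1)| ≤ eps ‖f i‖`, and `D (f j)`
supplies the summand with `s = 0` because `‖f 0‖ = 1`. -/
theorem norm_succ_le (hf : IsFDSequence R V D mu f) (hb : IsEigenbasis R V lam b)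
    (hmu : mu 0 = lam n) (hD : ∀ x, ‖D x‖ ≤ eps * ‖x‖) (j : ℕ) :
    ‖f (j + 1)‖ ≤ invGap lam n * eps *
      ∑ s ∈ Finset.range (j + 1), ‖f s‖ * ‖f (j - s)‖ := by
  obtain ⟨c, hc, h0⟩ := hf.inner_basis hb hmu
  have hM := invGap_pos hb.strictMono n
  have h1 := hb.norm_le (hmu ▸ hf.solves (j + 1)) (hf.inner_succ_basis hb hmu j)
    (g' := ∑ s ∈ Finset.range j, mu (j - s) • f (s + 1) - D (f j)) (fun k hk => by
      rw [fdSource, Finset.sum_range_succ', h0, inner_sub_left, inner_sub_left, inner_add_left,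
        inner_smul_left, inner_smul_left, b.orthonormal.2 hk.symm]
      simp)
  refine h1.trans ?_
  rw [mul_assoc]
  refine mul_le_mul_of_nonneg_left ?_ hM.le
  rw [Finset.sum_range_succ', mul_add, Finset.mul_sum, hf.norm_zero, one_mul, Nat.sub_zero]
  refine (norm_sub_le _ _).trans (add_le_add ((norm_sum_le _ _).trans ?_) (hD _))
  refine Finset.sum_le_sum fun s hs => ?_
  have hs := Finset.mem_range.1 hs
  have h2 := hf.abs_mu_succ_le hb hmu hD (j - (s + 1))
  rw [show j - (s + 1) + 1 = j - s by lia] at h2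
  rw [norm_smul, Real.norm_eq_abs]
  nlinarith [norm_nonneg (f (s + 1))]

/-- The preceding inequality is the Catalan convolution with a factor `M eps` per step, and the
powers of that factor combine to the `j`-th in each summand. -/
theorem norm_le_catalan (hf : IsFDSequence R V D mu f) (hb : IsEigenbasis R V lam b)
    (hmu : mu 0 = lam n) (heps : 0 ≤ eps) (hD : ∀ x, ‖D x‖ ≤ eps * ‖x‖) (j : ℕ) :
    ‖f j‖ ≤ (invGap lam n * eps) ^ j * catalan j := by
  have hM := invGap_pos hb.strictMono n
  induction j using Nat.strong_induction_on with
  | _ j ih =>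
    cases j with
    | zero => simp [hf.norm_zero]
    | succ j =>
      refine (hf.norm_succ_le hb hmu hD j).trans ?_
      rw [pow_succ', mul_assoc (invGap lam n * eps)]
      refine mul_le_mul_of_nonneg_left ?_ (by positivity)
      have hc : (catalan (j + 1) : ℝ) =
          ∑ s ∈ Finset.range (j + 1), (catalan s : ℝ) * catalan (j - s) := by
        rw [catalan_succ', Finset.Nat.sum_antidiagonal_eq_sum_range_succ
          (fun x y => catalan x * catalan y)]
        push_cast; rfl
      rw [hc, Finset.mul_sum]
      refine Finset.sum_le_sum fun s hs => ?_
      have hs := Finset.mem_range.1 hs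
      have h3 : (invGap lam n * eps) ^ j * ((catalan s : ℝ) * catalan (j - s)) =
          ((invGap lam n * eps) ^ s * catalan s) *
            ((invGap lam n * eps) ^ (j - s) * catalan (j - s)) := by
        nth_rw 1 [show j = s + (j - s) by lia]
        rw [pow_add]; ring
      rw [h3]
      exact mul_le_mul (ih s (by lia)) (ih (j - s) (by lia)) (norm_nonneg _) (by positivity)

theorem norm_le_alphaFD (hf : IsFDSequence R V D mu f) (hb : IsEigenbasis R V lam b)
    (hmu : mu 0 = lam n) (heps : 0 ≤ eps) (hD : ∀ x, ‖D x‖ ≤ eps * ‖x‖) (j : ℕ) :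
    ‖f j‖ ≤ (4 * (invGap lam n * eps)) ^ j * alphaFD j := by
  refine (hf.norm_le_catalan hb hmu heps hD j).trans_eq ?_
  rw [catalan_eq_alphaFD, mul_pow]; ring

theorem abs_mu_succ_le_alphaFD (hf : IsFDSequence R V D mu f) (hb : IsEigenbasis R V lam b)
    (hmu : mu 0 = lam n) (heps : 0 ≤ eps) (hD : ∀ x, ‖D x‖ ≤ eps * ‖x‖) (j : ℕ) :
    |mu (j + 1)| ≤ eps * ((4 * (invGap lam n * eps)) ^ j * alphaFD j) :=
  (hf.abs_mu_succ_le hb hmu hD j).trans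
    (mul_le_mul_of_nonneg_left (hf.norm_le_alphaFD hb hmu heps hD j) heps)

variable [CompleteSpace H]

/-- The perturbation series converges to an eigenpair of `R⁻¹ + V + D`, and the limit of the
eigenvalue series is the eigenvalue with the same index. -/
theorem exists_hasSum (hf : IsFDSequence R V D mu f) (hb : IsEigenbasis R V lam b)
    (hb' : IsEigenbasis R (V + D) lam' b') (hmu : mu 0 = lam n) (heps : 0 ≤ eps)
    (hD : ∀ x, ‖D x‖ ≤ eps * ‖x‖) (hsmall : invGap lam n * eps ≤ 1 / 4) :
    ∃ U, HasSum f U ∧ HasSum mu (lam' n) ∧ ResolventEq R (V + D) (lam' n) 0 U ∧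
      ⟪U, f 0⟫_ℝ = 1 := by
  have hM := invGap_pos hb.strictMono n
  have hr0 : 0 ≤ 4 * (invGap lam n * eps) := by positivity
  have hr1 : ∀ j, (4 * (invGap lam n * eps)) ^ j ≤ 1 := fun j => pow_le_one₀ hr0 (by linarith)
  have hbound : ∀ j, ‖f j‖ ≤ alphaFD j := fun j =>
    (hf.norm_le_alphaFD hb hmu heps hD j).trans
      (mul_le_of_le_one_left (alphaFD_pos j).le (hr1 j))
  have hmubound : ∀ j, |mu (j + 1)| ≤ eps * alphaFD j := fun j =>
    (hf.abs_mu_succ_le hb hmu hD j).trans (mul_le_mul_of_nonneg_left (hbound j) heps)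
  have hfs : Summable fun j => ‖f j‖ :=
    Summable.of_nonneg_of_le (fun _ => norm_nonneg _) hbound summable_alphaFD
  have hms' : Summable fun j => |mu (j + 1)| :=
    Summable.of_nonneg_of_le (fun _ => abs_nonneg _) hmubound (summable_alphaFD.mul_left eps)
  have hms : Summable fun j => ‖mu j‖ := (summable_nat_add_iff 1).1 hms'
  obtain ⟨U, hU⟩ := hfs.of_norm
  obtain ⟨L, hL⟩ := hms.of_norm
  have hUf : ⟪U, f 0⟫_ℝ = 1 := by
    have h1 : HasSum (fun j => ⟪f j, f 0⟫_ℝ) ⟪U, f 0⟫_ℝ := by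
      have := (innerSL ℝ (f 0)).hasSum hU
      simp only [innerSL_apply_apply] at this
      simpa only [real_inner_comm (f 0)] using this
    simp only [hf.orthogonal] at h1
    exact h1.unique (hasSum_ite_eq 0 1)
  have hU0 : U ≠ 0 := by
    rintro rfl
    simp at hUf
  -- The correction equations are summed over `j`. The convolution of `mu` with `f` is the part of
  -- the source without `D`, plus the term `mu 0 • f j`; the `D` part is shifted by one index and
  -- contributes `0` at `j = 0`.
  have hLU : ResolventEq R (V + D) L 0 U := by
    have h1 := hL.smul_cauchyProduct hU hms hfs
    have h2 : HasSum (fun j => fdSource D mu f j + mu 0 • f j) (L • U - D U) := by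
      have hD0 : HasSum (fun j => Nat.casesOn j (0 : H) fun i => D (f i)) (D U) := by
        rw [← hasSum_nat_add_iff' 1]
        simpa using D.hasSum hU
      refine (h1.sub hD0).congr_fun fun j => ?_
      cases j with
      | zero => simp [fdSource]
      | succ j =>
        rw [Finset.Nat.sum_antidiagonal_eq_sum_range_succ (fun x y => mu x • f y),
          ← Finset.sum_range_reflect, Finset.sum_range_succ]
        simp only [fdSource]
        have : ∑ s ∈ Finset.range (j + 1), mu (j + 1 + 1 - 1 - s) • f (j + 1 - (j + 1 + 1 - 1 - s))
            = ∑ s ∈ Finset.range (j + 1), mu (j + 1 - s) • f s := by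
          refine Finset.sum_congr rfl fun s hs => ?_
          have := Finset.mem_range.1 hs
          rw [show j + 1 + 1 - 1 - s = j + 1 - s by lia, show j + 1 - (j + 1 - s) = s by lia]
        rw [this]
        simp
        abel
    have h3 := R.hasSum (h2.sub (V.hasSum hU))
    have h4 := h3.unique (hU.congr_fun fun j => by
      have := hf.solves j
      unfold ResolventEq at this
      conv_rhs => rw [← this]
      congr 1
      abel)
    unfold ResolventEq
    conv_rhs => rw [← h4]
    congr 1
    simp only [add_apply]
    abel
  obtain ⟨k, hk⟩ := hb'.mem_range hLU hU0
  have hdist : |L - lam n| ≤ 2 * eps := by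
    have h1 : HasSum (fun j => mu (j + 1)) (L - lam n) := by
      rw [hasSum_nat_add_iff' 1 |>.symm] at hL
      simpa [hmu] using hL
    have h2 := h1.norm_le_of_bounded (summable_alphaFD.hasSum.mul_left eps) hmubound
    have h3 : ∑' j, alphaFD j ≤ 2 :=
      Real.tsum_le_of_sum_range_le (fun j => (alphaFD_pos j).le) sum_range_alphaFD_le
    rw [Real.norm_eq_abs] at h2
    nlinarith
  -- If `k ≠ n`, then `|lam k - lam n| ≤ 2 eps + eps`, so `M |lam k - lam n| ≤ 3 / 4`, whereas the
  -- gap makes this product at least `1`.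
  have hkn : k = n := by
    by_contra hne
    have h1 := one_le_invGap_mul hb.strictMono hne
    have h2 := hb.abs_eigenvalue_sub_le hb' hD k
    rw [hk] at h2
    have h3 : |lam k - lam n| ≤ 3 * eps := by
      rw [abs_le] at *
      constructor <;> linarith
    have h4 := mul_le_mul_of_nonneg_left h3 hM.le
    linarith
  subst hkn
  subst hk
  exact ⟨U, hU, hL, hLU, hUf⟩

end IsFDSequence

/-- Corrections built recursively from a solution operator `T` for the correction equations. -/
noncomputable def fdSeq (T : H → H) (D : H →L[ℝ] H) (f₀ : H) : ℕ → H
  | 0 => f₀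
  | j + 1 => T (∑ s : Fin (j + 1),
      ⟪D (fdSeq T D f₀ (j - s)), f₀⟫_ℝ • fdSeq T D f₀ s - D (fdSeq T D f₀ j))
  decreasing_by all_goals lia

/-- Choosing the next eigenvalue correction as `⟪D (f j), b n⟫` makes the next source orthogonal to
`b n`, which is exactly what solvability requires. -/
theorem IsEigenbasis.exists_isFDSequence [CompleteSpace H] (hb : IsEigenbasis R V lam b)
    (hR : IsCompactOperator R) (D : H →L[ℝ] H) (n : ℕ) :
    ∃ (mu : ℕ → ℝ) (f : ℕ → H), mu 0 = lam n ∧ IsFDSequence R V D mu f := by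
  -- The solution operator is made total, with value `0` on inadmissible sources, so that the
  -- recursion can be defined before its solvability is known.
  have hT : ∀ g, ∃ u, ⟪g, b n⟫_ℝ = 0 → ResolventEq R V (lam n) g u ∧ ⟪u, b n⟫_ℝ = 0 := fun g => by
    by_cases hg : ⟪g, b n⟫_ℝ = 0
    · obtain ⟨u, hu⟩ := hb.exists_solution hR hg
      exact ⟨u, fun _ => hu⟩
    · exact ⟨0, fun h => absurd h hg⟩
  choose T hT using hT
  set f := fdSeq T D (b n) with hfdef
  set mu : ℕ → ℝ := fun j => Nat.casesOn j (lam n) fun i => ⟪D (f i), b n⟫_ℝ with hmudef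
  have hf0 : f 0 = b n := by rw [hfdef, fdSeq]
  have hfs : ∀ j, f (j + 1) = T (fdSource D mu f (j + 1)) := by
    intro j
    rw [hfdef, fdSeq, fdSource, ← Fin.sum_univ_eq_sum_range (fun s => mu (j + 1 - s) • f s)]
    congr 2
    refine Finset.sum_congr rfl fun s _ => ?_
    rw [show j + 1 - (s : ℕ) = (j - s) + 1 by lia]
  have key : ∀ j, ResolventEq R V (lam n) (fdSource D mu f j) (f j) ∧
      ⟪f j, b n⟫_ℝ = if j = 0 then 1 else 0 := by
    intro j
    induction j using Nat.strong_induction_on with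
    | _ j ih =>
      cases j with
      | zero =>
        rw [hf0, if_pos rfl]
        exact ⟨hb.eigen n, b.inner_self_eq_one n⟩
      | succ j =>
        rw [hfs, if_neg j.succ_ne_zero]
        refine hT _ ?_
        rw [fdSource, inner_sub_left, sum_inner, Finset.sum_eq_single 0]
        · rw [inner_smul_left, (ih 0 (by lia)).2, if_pos rfl]
          simp [hmudef]
        · intro s hs h0
          rw [inner_smul_left, (ih s (Finset.mem_range.1 hs)).2, if_neg h0, mul_zero]
        · simp
  exact ⟨mu, f, rfl, fun j => (key j).1, fun j => hf0 ▸ (key j).2⟩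

end FDSequence

/-! ### Flux and potential of a source in `L²(-1, 1)` -/

/-- Lebesgue measure on `(-1, 1)`. -/
noncomputable abbrev unitMeasure : Measure ℝ := volume.restrict (Ioo (-1 : ℝ) 1)

/-- The Hilbert space `L²(-1, 1)`. -/
abbrev L2Unit : Type := Lp ℝ 2 unitMeasure

theorem integral_unitMeasure (f : ℝ → ℝ) : ∫ x, f x ∂unitMeasure = ∫ x in (-1 : ℝ)..1, f x := by
  rw [intervalIntegral.integral_of_le (by norm_num), integral_Ioc_eq_integral_Ioo]

theorem intervalIntegrable_of_unitMeasure {f : ℝ → ℝ} (hf : Integrable f unitMeasure) :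
    IntervalIntegrable f volume (-1) 1 := by
  rw [intervalIntegrable_iff_integrableOn_Ioo_of_le (by norm_num)]
  exact hf

theorem intervalIntegrable_sub_interval {f : ℝ → ℝ} (hf : IntervalIntegrable f volume (-1) 1)
    {a b : ℝ} (ha : a ∈ Icc (-1 : ℝ) 1) (hb : b ∈ Icc (-1 : ℝ) 1) :
    IntervalIntegrable f volume a b := by
  refine hf.mono_set ?_
  rw [uIcc_of_le (show (-1 : ℝ) ≤ 1 by norm_num)]
  exact uIcc_subset_Icc ha hb

namespace L2Unit

theorem integrable (f : L2Unit) : Integrable f unitMeasure :=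
  (Lp.memLp f).integrable one_le_two

theorem intervalIntegrable (f : L2Unit) : IntervalIntegrable f volume (-1) 1 :=
  intervalIntegrable_of_unitMeasure f.integrable

/-- The constant function `1`. -/
noncomputable def one : L2Unit := indicatorConstLp 2 MeasurableSet.univ (measure_ne_top _ _) 1

/-- The mean value over `(-1, 1)`. -/
noncomputable def mean (f : L2Unit) : ℝ := 1 / 2 * ⟪one, f⟫_ℝ

/-- The function representing `f ↦ ∫ t in -1..x, (f t - mean f)`. -/
noncomputable def fluxVec (x : ℝ) : L2Unit :=
  indicatorConstLp 2 (measurableSet_Ioo (a := (-1 : ℝ)) (b := x)) (measure_ne_top _ _) 1 -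
    ((1 + x) / 2) • one

/-- The primitive from `-1` of `f - mean f`. -/
noncomputable def flux (f : L2Unit) (x : ℝ) : ℝ := ⟪fluxVec x, f⟫_ℝ

theorem one_ae : (one : ℝ → ℝ) =ᵐ[unitMeasure] fun _ => 1 := by
  filter_upwards [indicatorConstLp_coeFn (p := 2) (μ := unitMeasure) (hs := MeasurableSet.univ)
    (hμs := measure_ne_top _ _) (c := (1 : ℝ))] with x hx
  rw [one, hx]; simp

theorem inner_one (f : L2Unit) : ⟪one, f⟫_ℝ = ∫ x in (-1 : ℝ)..1, f x := by
  rw [one, L2.inner_indicatorConstLp_one, Measure.restrict_univ, integral_unitMeasure]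

theorem mean_eq (f : L2Unit) : mean f = 1 / 2 * ∫ x in (-1 : ℝ)..1, f x := by
  rw [mean, inner_one]

theorem measureReal_Ioo {x : ℝ} (hx : x ∈ Icc (-1 : ℝ) 1) :
    unitMeasure.real (Ioo (-1) x) = 1 + x := by
  rw [measureReal_restrict_apply measurableSet_Ioo,
    inter_eq_left.2 (Ioo_subset_Ioo_right hx.2), Real.volume_real_Ioo_of_le hx.1]
  ring

theorem measureReal_univ : unitMeasure.real univ = 2 := by
  rw [measureReal_restrict_apply MeasurableSet.univ, univ_inter,
    Real.volume_real_Ioo_of_le (by norm_num)]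
  norm_num

theorem inner_one_one : ⟪one, one⟫_ℝ = 2 := by
  rw [one, L2.real_inner_indicatorConstLp_one_indicatorConstLp_one, univ_inter, measureReal_univ]

theorem flux_eq (f : L2Unit) {x : ℝ} (hx : x ∈ Icc (-1 : ℝ) 1) :
    flux f x = ∫ t in (-1 : ℝ)..x, (f t - mean f) := by
  have h1 : IntervalIntegrable f volume (-1) x :=
    intervalIntegrable_sub_interval f.intervalIntegrable (by simp) hx
  rw [flux, fluxVec, inner_sub_left, inner_smul_left, L2.inner_indicatorConstLp_one,
    intervalIntegral.integral_sub h1 (by simp), Measure.restrict_restrict measurableSet_Ioo,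
    inter_eq_left.2 (Ioo_subset_Ioo_right hx.2), intervalIntegral.integral_of_le hx.1,
    integral_Ioc_eq_integral_Ioo]
  simp [mean]
  ring

/-- Projecting the indicator of `(-1, x)` off the constants makes its norm vanish at both endpoints.
By Cauchy–Schwarz the flux is then `O(√(1 - x²))`, and dividing it by `1 - x²` leaves an integrable
singularity. -/
theorem norm_fluxVec_sq {x : ℝ} (hx : x ∈ Icc (-1 : ℝ) 1) :
    ‖fluxVec x‖ ^ 2 = (1 - x ^ 2) / 2 := by
  rw [← real_inner_self_eq_norm_sq, fluxVec, inner_sub_left, inner_sub_right, inner_sub_right,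
    inner_smul_left, inner_smul_right, inner_smul_left, inner_smul_right, inner_one_one, one,
    L2.real_inner_indicatorConstLp_one_indicatorConstLp_one,
    L2.real_inner_indicatorConstLp_one_indicatorConstLp_one,
    L2.real_inner_indicatorConstLp_one_indicatorConstLp_one, inter_self, univ_inter, inter_univ,
    measureReal_Ioo hx]
  simp only [RCLike.conj_to_real]
  ring

theorem flux_one {x : ℝ} (hx : x ∈ Icc (-1 : ℝ) 1) : flux one x = 0 := by
  rw [flux, fluxVec, inner_sub_left, inner_smul_left, inner_one_one, one,
    L2.real_inner_indicatorConstLp_one_indicatorConstLp_one, inter_univ, measureReal_Ioo hx]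
  simp only [RCLike.conj_to_real]
  ring

theorem abs_flux_le (f : L2Unit) {x : ℝ} (hx : x ∈ Icc (-1 : ℝ) 1) :
    |flux f x| ≤ ‖f‖ * √(1 - x ^ 2) := by
  have h0 : 0 ≤ 1 - x ^ 2 := by nlinarith [hx.1, hx.2]
  have h1 : ‖fluxVec x‖ ≤ √(1 - x ^ 2) := by
    refine Real.le_sqrt_of_sq_le ?_
    rw [norm_fluxVec_sq hx]
    linarith
  rw [flux, mul_comm]
  exact (abs_real_inner_le_norm _ _).trans (mul_le_mul_of_nonneg_right h1 (norm_nonneg _))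

theorem flux_add (f g : L2Unit) (x : ℝ) : flux (f + g) x = flux f x + flux g x :=
  inner_add_right _ _ _

theorem flux_smul (c : ℝ) (f : L2Unit) (x : ℝ) : flux (c • f) x = c * flux f x :=
  inner_smul_right _ _ _

theorem flux_neg_one (f : L2Unit) : flux f (-1) = 0 := by
  have := f.abs_flux_le (x := -1) (by simp)
  simpa using this

theorem flux_one_right (f : L2Unit) : flux f 1 = 0 := by
  have := f.abs_flux_le (x := 1) (by simp)
  simpa using this

theorem intervalIntegrable_sub_mean (f : L2Unit) :
    IntervalIntegrable (fun t => f t - mean f) volume (-1) 1 :=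
  f.intervalIntegrable.sub (by simp)

theorem continuousOn_flux (f : L2Unit) : ContinuousOn (flux f) (Icc (-1) 1) := by
  have h := intervalIntegral.continuousOn_primitive_interval' f.intervalIntegrable_sub_mean
    (a := -1) (by simp)
  rw [uIcc_of_le (by norm_num)] at h
  exact h.congr fun x hx => f.flux_eq hx

theorem abs_flux_div_le (f : L2Unit) {x : ℝ} (hx : x ∈ Icc (-1 : ℝ) 1) :
    |flux f x / (1 - x ^ 2)| ≤ ‖f‖ * √(1 - x ^ 2)⁻¹ := by
  have h0 : 0 ≤ 1 - x ^ 2 := by nlinarith [hx.1, hx.2]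
  rw [abs_div, abs_of_nonneg h0, Real.sqrt_inv]
  rcases h0.eq_or_lt with h | h
  · rw [← h]; simp
  · rw [div_le_iff₀ h]
    refine (f.abs_flux_le hx).trans_eq ?_
    have h2 : √(1 - x ^ 2) ≠ 0 := (Real.sqrt_pos.2 h).ne'
    field_simp
    rw [Real.sq_sqrt h0]

theorem one_sub_sq_pos {x : ℝ} (hx : x ∈ Ioo (-1 : ℝ) 1) : 0 < 1 - x ^ 2 := by
  nlinarith [hx.1, hx.2]

theorem continuousOn_flux_div (f : L2Unit) :
    ContinuousOn (fun t => flux f t / (1 - t ^ 2)) (Ioo (-1) 1) :=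
  (f.continuousOn_flux.mono Ioo_subset_Icc_self).div (by fun_prop)
    fun _ hx => (one_sub_sq_pos hx).ne'

theorem intervalIntegrable_flux_div (f : L2Unit) :
    IntervalIntegrable (fun t => flux f t / (1 - t ^ 2)) volume (-1) 1 := by
  have h1 := Polynomial.Chebyshev.intervalIntegrable_sqrt_one_sub_sq_inv.const_mul ‖f‖
  rw [intervalIntegrable_iff_integrableOn_Ioo_of_le (by norm_num)] at h1 ⊢
  refine h1.mono' (f.continuousOn_flux_div.aestronglyMeasurable measurableSet_Ioo) ?_
  refine (ae_restrict_iff' measurableSet_Ioo).2 (Eventually.of_forall fun x hx => ?_)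
  exact f.abs_flux_div_le (Ioo_subset_Icc_self hx)

/-- The bounded solution `w` of `-((1 - x²) w')' = f - mean f` with `w 0 = 0`. -/
noncomputable def pot (f : L2Unit) (x : ℝ) : ℝ := -∫ t in (0 : ℝ)..x, flux f t / (1 - t ^ 2)

theorem zero_mem_Icc : (0 : ℝ) ∈ Icc (-1 : ℝ) 1 := by constructor <;> norm_num

theorem integral_sqrt_inv {a b : ℝ} (ha : a ∈ Icc (-1 : ℝ) 1) (hb : b ∈ Icc (-1 : ℝ) 1)
    (hab : a ≤ b) : ∫ x in a..b, √(1 - x ^ 2)⁻¹ = Real.arcsin b - Real.arcsin a := by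
  refine intervalIntegral.integral_eq_sub_of_hasDerivAt_of_le hab
    Real.continuous_arcsin.continuousOn (fun x hx => ?_)
    (intervalIntegrable_sub_interval
      Polynomial.Chebyshev.intervalIntegrable_sqrt_one_sub_sq_inv ha hb)
  have := Real.hasDerivAt_arcsin (x := x) (by linarith [ha.1, hx.1]) (by linarith [hb.2, hx.2])
  rwa [one_div, ← Real.sqrt_inv] at this

/-- Since `1 / √(1 - x²)` is the derivative of `arcsin`, the latter serves as a modulus of
continuity uniform over the unit ball and up to the endpoints. -/
theorem abs_pot_sub_le (f : L2Unit) {a b : ℝ} (ha : a ∈ Icc (-1 : ℝ) 1) (hb : b ∈ Icc (-1 : ℝ) 1) :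
    |pot f a - pot f b| ≤ ‖f‖ * |Real.arcsin a - Real.arcsin b| := by
  wlog hab : a ≤ b generalizing a b
  · rw [abs_sub_comm, abs_sub_comm (Real.arcsin a)]
    exact this hb ha (le_of_not_ge hab)
  have hi := fun {c : ℝ} (hc : c ∈ Icc (-1 : ℝ) 1) =>
    intervalIntegrable_sub_interval f.intervalIntegrable_flux_div zero_mem_Icc hc
  have h1 : pot f a - pot f b = ∫ t in a..b, flux f t / (1 - t ^ 2) := by
    rw [pot, pot, ← intervalIntegral.integral_interval_sub_left (hi hb) (hi ha)]
    ring
  have h2 := intervalIntegral.norm_integral_le_abs_of_norm_le (μ := volume) (a := a) (b := b)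
    (f := fun t => flux f t / (1 - t ^ 2)) (g := fun t => ‖f‖ * √(1 - t ^ 2)⁻¹)
    ((ae_restrict_iff' measurableSet_uIoc).2 (Eventually.of_forall fun t ht =>
      f.abs_flux_div_le (uIcc_subset_Icc ha hb (uIoc_subset_uIcc ht))))
    ((intervalIntegrable_sub_interval
      Polynomial.Chebyshev.intervalIntegrable_sqrt_one_sub_sq_inv ha hb).const_mul _)
  rw [h1]
  refine h2.trans_eq ?_
  rw [intervalIntegral.integral_const_mul, integral_sqrt_inv ha hb hab, abs_mul, abs_norm,
    abs_sub_comm]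

theorem pot_add (f g : L2Unit) {x : ℝ} (hx : x ∈ Icc (-1 : ℝ) 1) :
    pot (f + g) x = pot f x + pot g x := by
  simp only [pot, flux_add, add_div]
  rw [intervalIntegral.integral_add, neg_add]
  exacts [intervalIntegrable_sub_interval f.intervalIntegrable_flux_div zero_mem_Icc hx,
    intervalIntegrable_sub_interval g.intervalIntegrable_flux_div zero_mem_Icc hx]

theorem pot_smul (c : ℝ) (f : L2Unit) (x : ℝ) : pot (c • f) x = c * pot f x := by
  simp only [pot, flux_smul, mul_div_assoc]
  rw [intervalIntegral.integral_const_mul, mul_neg]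

theorem pot_one {x : ℝ} (hx : x ∈ Icc (-1 : ℝ) 1) : pot one x = 0 := by
  rw [pot, neg_eq_zero]
  refine (intervalIntegral.integral_congr fun t ht => ?_).trans intervalIntegral.integral_zero
  simp [flux_one (uIcc_subset_Icc zero_mem_Icc hx ht)]

theorem abs_pot_le (f : L2Unit) {x : ℝ} (hx : x ∈ Icc (-1 : ℝ) 1) :
    |pot f x| ≤ ‖f‖ * (Real.pi / 2) := by
  have h := f.abs_pot_sub_le hx zero_mem_Icc
  have h0 : pot f 0 = 0 := by simp [pot]
  rw [h0, sub_zero, Real.arcsin_zero, sub_zero] at h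
  exact h.trans (mul_le_mul_of_nonneg_left
    (abs_le.2 ⟨Real.neg_pi_div_two_le_arcsin x, Real.arcsin_le_pi_div_two x⟩) (norm_nonneg _))

theorem continuousOn_pot (f : L2Unit) : ContinuousOn (pot f) (Icc (-1) 1) := by
  have h := intervalIntegral.continuousOn_primitive_interval' f.intervalIntegrable_flux_div
    (a := 0) (by rw [uIcc_of_le (by norm_num)]; exact zero_mem_Icc)
  rw [uIcc_of_le (by norm_num)] at h
  exact h.neg

theorem hasDerivAt_pot (f : L2Unit) {x : ℝ} (hx : x ∈ Ioo (-1 : ℝ) 1) :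
    HasDerivAt (pot f) (-(flux f x / (1 - x ^ 2))) x := by
  have hc : ContinuousAt (fun t => flux f t / (1 - t ^ 2)) x :=
    f.continuousOn_flux_div.continuousAt (isOpen_Ioo.mem_nhds hx)
  refine (intervalIntegral.integral_hasDerivAt_right
    (intervalIntegrable_sub_interval f.intervalIntegrable_flux_div zero_mem_Icc
      (Ioo_subset_Icc_self hx)) ?_ hc).neg
  exact f.continuousOn_flux_div.stronglyMeasurableAtFilter isOpen_Ioo x hx

/-- Green's identity. -/
theorem integral_pot_mul (f g : L2Unit) :
    ∫ x in (-1 : ℝ)..1, pot f x * (g x - mean g) =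
      ∫ x in (-1 : ℝ)..1, flux f x * flux g x / (1 - x ^ 2) := by
  have hle : (-1 : ℝ) ≤ 1 := by norm_num
  have hpot : AbsolutelyContinuousOnInterval (pot f) (-1) 1 :=
    (f.intervalIntegrable_flux_div.absolutelyContinuousOnInterval_intervalIntegral
      (by rw [uIcc_of_le hle]; exact zero_mem_Icc)).neg
  set G : ℝ → ℝ := fun x => ∫ t in (-1 : ℝ)..x, (g t - mean g) with hG
  have hGac : AbsolutelyContinuousOnInterval G (-1) 1 :=
    g.intervalIntegrable_sub_mean.absolutelyContinuousOnInterval_intervalIntegral (by simp)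
  have hGflux : ∀ x ∈ Icc (-1 : ℝ) 1, G x = flux g x := fun x hx => (g.flux_eq hx).symm
  -- Both factors are absolutely continuous on the closed interval. The boundary terms vanish
  -- because `flux g` does at `±1`.
  have h := hpot.integral_mul_deriv_eq_deriv_mul hGac
  rw [hGflux 1 (by simp), hGflux (-1) (by simp), flux_neg_one, flux_one_right, mul_zero, mul_zero,
    sub_zero, zero_sub, ← intervalIntegral.integral_neg] at h
  have hL : ∫ x in (-1 : ℝ)..1, pot f x * (g x - mean g) =
      ∫ x in (-1 : ℝ)..1, pot f x * deriv G x := by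
    refine intervalIntegral.integral_congr_ae ?_
    filter_upwards [g.intervalIntegrable_sub_mean.ae_hasDerivAt_integral] with x hx hx'
    rw [(hx (uIoc_subset_uIcc hx') (-1) (by simp)).deriv]
  rw [hL, h]
  refine intervalIntegral.integral_congr_ae ?_
  have hne : ∀ᵐ x : ℝ, x ≠ 1 := by simp [ae_iff, measure_singleton]
  filter_upwards [hne] with x hx1 hx
  rw [uIoc_of_le hle] at hx
  have hxo : x ∈ Ioo (-1 : ℝ) 1 := ⟨hx.1, lt_of_le_of_ne hx.2 hx1⟩
  rw [(f.hasDerivAt_pot hxo).deriv, hGflux x (Ioo_subset_Icc_self hxo)]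
  ring

end L2Unit

/-! ### The Green operator: compactness, symmetry, positivity -/

namespace L2Unit

/-- `pot f` as a bounded continuous function on `[-1, 1]`. -/
noncomputable def potBCF (f : L2Unit) : Icc (-1 : ℝ) 1 →ᵇ ℝ :=
  BoundedContinuousFunction.mkOfCompact
    ⟨fun x => pot f x, continuousOn_iff_continuous_domRestrict.1 f.continuousOn_pot⟩

/-- The class in `L²(-1, 1)` of a continuous function on `[-1, 1]`. -/
noncomputable def ofIcc (g : Icc (-1 : ℝ) 1 →ᵇ ℝ) : L2Unit :=
  BoundedContinuousFunction.toLp 2 unitMeasure ℝ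
    (g.compContinuous ⟨projIcc (-1 : ℝ) 1 (by norm_num), continuous_projIcc⟩)

theorem continuous_ofIcc : Continuous ofIcc :=
  (BoundedContinuousFunction.toLp 2 unitMeasure ℝ).continuous.comp
    (BoundedContinuousFunction.continuous_compContinuous _)

theorem ofIcc_ae (g : Icc (-1 : ℝ) 1 →ᵇ ℝ) :
    ofIcc g =ᵐ[unitMeasure] fun x => g (projIcc (-1 : ℝ) 1 (by norm_num) x) :=
  BoundedContinuousFunction.coeFn_toLp _ _ _ _

theorem ae_mem_Ioo : ∀ᵐ x ∂unitMeasure, x ∈ Ioo (-1 : ℝ) 1 := ae_restrict_mem measurableSet_Ioo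

theorem ofIcc_potBCF_ae (f : L2Unit) : ofIcc (potBCF f) =ᵐ[unitMeasure] pot f := by
  filter_upwards [ofIcc_ae (potBCF f), ae_mem_Ioo] with x hx hxm
  rw [hx, projIcc_of_mem _ (Ioo_subset_Icc_self hxm)]
  rfl

/-- The operator `pot` on `L²(-1, 1)`. -/
noncomputable def potCLM : L2Unit →L[ℝ] L2Unit :=
  LinearMap.mkContinuous
    { toFun := fun f => ofIcc (potBCF f)
      map_add' := fun f g => by
        refine Lp.ext ?_
        filter_upwards [ofIcc_potBCF_ae (f + g), ofIcc_potBCF_ae f, ofIcc_potBCF_ae g,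
          Lp.coeFn_add (ofIcc (potBCF f)) (ofIcc (potBCF g)), ae_mem_Ioo] with x h1 h2 h3 h4 hx
        rw [h1, h4, Pi.add_apply, h2, h3, pot_add _ _ (Ioo_subset_Icc_self hx)]
      map_smul' := fun c f => by
        refine Lp.ext ?_
        filter_upwards [ofIcc_potBCF_ae (c • f), ofIcc_potBCF_ae f,
          Lp.coeFn_smul c (ofIcc (potBCF f))] with x h1 h2 h3
        rw [h1, RingHom.id_apply, h3, Pi.smul_apply, h2, pot_smul, smul_eq_mul] }
    (‖(BoundedContinuousFunction.toLp 2 unitMeasure ℝ : (ℝ →ᵇ ℝ) →L[ℝ] L2Unit)‖ * (Real.pi / 2))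
    (fun f => by
      refine ((BoundedContinuousFunction.toLp 2 unitMeasure ℝ : (ℝ →ᵇ ℝ) →L[ℝ] L2Unit).le_opNorm
        _).trans ?_
      rw [mul_assoc]
      refine mul_le_mul_of_nonneg_left ?_ (norm_nonneg _)
      refine (BoundedContinuousFunction.norm_le (by positivity)).2 fun x => ?_
      rw [mul_comm]
      exact f.abs_pot_le (projIcc (-1 : ℝ) 1 (by norm_num) x).2)

theorem potCLM_ae (f : L2Unit) : potCLM f =ᵐ[unitMeasure] pot f := ofIcc_potBCF_ae f

theorem potCLM_one : potCLM one = 0 := by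
  refine Lp.ext ?_
  filter_upwards [potCLM_ae one, Lp.coeFn_zero ℝ 2 unitMeasure, ae_mem_Ioo] with x h1 h2 hx
  rw [h1, h2, pot_one (Ioo_subset_Icc_self hx), Pi.zero_apply]

/-- Arzelà–Ascoli: the image of the unit ball is bounded by `π / 2` and has `arcsin` as a common
modulus of continuity. Uniform convergence then passes to `L²`. -/
theorem isCompactOperator_potCLM : IsCompactOperator potCLM := by
  set A : Set (Icc (-1 : ℝ) 1 →ᵇ ℝ) := potBCF '' Metric.closedBall 0 1 with hA
  have hK : IsCompact (closure A) := by
    refine BoundedContinuousFunction.arzela_ascoli (Icc (-(Real.pi / 2)) (Real.pi / 2))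
      isCompact_Icc A ?_ ?_
    · rintro _ x ⟨f, hf, rfl⟩
      rw [mem_closedBall_zero_iff] at hf
      rw [mem_Icc, ← abs_le]
      refine (f.abs_pot_le x.2).trans ?_
      exact mul_le_of_le_one_left (by positivity) hf
    · intro x₀
      refine Metric.equicontinuousAt_of_continuity_modulus
        (fun x : Icc (-1 : ℝ) 1 => |Real.arcsin x₀ - Real.arcsin x|) ?_ _ (Eventually.of_forall ?_)
      · have h : Continuous fun x : Icc (-1 : ℝ) 1 => |Real.arcsin x₀ - Real.arcsin x| :=
          (continuous_const.sub (Real.continuous_arcsin.comp continuous_subtype_val)).abs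
        simpa using h.tendsto x₀
      · rintro x ⟨_, f, hf, rfl⟩
        rw [mem_closedBall_zero_iff] at hf
        exact (f.abs_pot_sub_le x₀.2 x.2).trans (mul_le_of_le_one_left (abs_nonneg _) hf)
  refine (isCompactOperator_iff_exists_mem_nhds_image_subset_compact _).2
    ⟨Metric.closedBall 0 1, Metric.closedBall_mem_nhds _ one_pos, ofIcc '' closure A,
      hK.image continuous_ofIcc, ?_⟩
  rintro _ ⟨f, hf, rfl⟩
  exact ⟨potBCF f, subset_closure ⟨f, hf, rfl⟩, rfl⟩

/-- The orthogonal projection onto the constants. -/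
noncomputable def meanCLM : L2Unit →L[ℝ] L2Unit :=
  ((1 / 2 : ℝ) • innerSL ℝ one).smulRight one

theorem meanCLM_apply (f : L2Unit) : meanCLM f = mean f • one := by
  simp [meanCLM, mean]

theorem mean_one : mean one = 1 := by rw [mean, inner_one_one]; norm_num

theorem mean_add (f g : L2Unit) : mean (f + g) = mean f + mean g := by
  simp only [mean, inner_add_right]; ring

theorem mean_sub (f g : L2Unit) : mean (f - g) = mean f - mean g := by
  simp only [mean, inner_sub_right]; ring

theorem mean_smul (c : ℝ) (f : L2Unit) : mean (c • f) = c * mean f := by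
  simp only [mean, inner_smul_right]; ring

theorem inner_meanCLM (f g : L2Unit) : ⟪meanCLM f, g⟫_ℝ = 2 * (mean f * mean g) := by
  rw [meanCLM_apply, inner_smul_left, mean, mean, RCLike.conj_to_real]; ring

theorem meanCLM_symm (f g : L2Unit) : ⟪meanCLM f, g⟫_ℝ = ⟪f, meanCLM g⟫_ℝ := by
  rw [real_inner_comm (meanCLM g), inner_meanCLM, inner_meanCLM, mul_comm (mean f)]

/-- The inverse of `u ↦ -((1 - x²) u')' + mean u` with the natural boundary conditions. -/
noncomputable def green : L2Unit →L[ℝ] L2Unit := potCLM - meanCLM ∘L potCLM + meanCLM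

theorem green_apply (f : L2Unit) :
    green f = potCLM f - mean (potCLM f) • one + mean f • one := by
  simp [green, meanCLM_apply]

theorem mean_green (f : L2Unit) : mean (green f) = mean f := by
  rw [green_apply, mean_add, mean_sub, mean_smul, mean_smul, mean_one]; ring

/-- Removing the mean of `pot f` amounts to pairing `pot f` with `g - mean g`, to which Green's
identity applies. Symmetry and nonnegativity of `green` can be read off the result. -/
theorem inner_green (f g : L2Unit) : ⟪green f, g⟫_ℝ =
    (∫ x in (-1 : ℝ)..1, flux f x * flux g x / (1 - x ^ 2)) + 2 * (mean f * mean g) := by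
  have h1 : ⟪green f, g⟫_ℝ = ⟪potCLM f, g - meanCLM g⟫_ℝ + ⟪meanCLM f, g⟫_ℝ := by
    rw [inner_sub_right, ← meanCLM_symm]
    simp [green, inner_add_left, inner_sub_left]
  rw [h1, inner_meanCLM, meanCLM_apply, ← integral_pot_mul, ← integral_unitMeasure,
    L2.inner_def]
  congr 1
  refine integral_congr_ae ?_
  filter_upwards [potCLM_ae f, Lp.coeFn_sub g (mean g • one), one_ae,
    Lp.coeFn_smul (mean g) one] with x h1 h2 h3 h4
  rw [h1, h2, Pi.sub_apply, h4, Pi.smul_apply, h3, smul_eq_mul, mul_one]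
  exact mul_comm _ _

theorem isCompactOperator_meanCLM : IsCompactOperator meanCLM := by
  have h : IsCompactOperator ((1 / 2 : ℝ) • innerSL ℝ one : L2Unit →L[ℝ] ℝ) :=
    isCompactOperator_of_locallyCompactSpace_dom
      ((1 / 2 : ℝ) • innerSL ℝ one : L2Unit →L[ℝ] ℝ)
  exact h.clm_comp ((1 : ℝ →L[ℝ] ℝ).smulRight one)

theorem isCompactOperator_green : IsCompactOperator green :=
  (isCompactOperator_potCLM.sub (isCompactOperator_potCLM.clm_comp meanCLM)).add
    isCompactOperator_meanCLM

theorem flux_sq_div_nonneg (f : L2Unit) {x : ℝ} (hx : x ∈ Icc (-1 : ℝ) 1) :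
    0 ≤ flux f x * flux f x / (1 - x ^ 2) :=
  div_nonneg (mul_self_nonneg _) (by nlinarith [hx.1, hx.2])

theorem integral_flux_sq_nonneg (f : L2Unit) :
    0 ≤ ∫ x in (-1 : ℝ)..1, flux f x * flux f x / (1 - x ^ 2) :=
  intervalIntegral.integral_nonneg (by norm_num) fun _ hx => f.flux_sq_div_nonneg hx

theorem eq_zero_of_flux (f : L2Unit) (hm : mean f = 0) (h : ∀ x ∈ Ioo (-1 : ℝ) 1, flux f x = 0) :
    f = 0 := by
  refine Lp.ext ?_
  have hd := f.intervalIntegrable_sub_mean.ae_hasDerivAt_integral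
  filter_upwards [ae_restrict_of_ae hd, Lp.coeFn_zero ℝ 2 unitMeasure, ae_mem_Ioo] with x h1 h2 hx
  have h3 := h1 (by rw [uIcc_of_le (by norm_num)]; exact Ioo_subset_Icc_self hx) (-1) (by simp)
  have h4 : (fun x => ∫ t in (-1 : ℝ)..x, (f t - mean f)) =ᶠ[𝓝 x] fun _ => 0 := by
    filter_upwards [isOpen_Ioo.mem_nhds hx] with y hy
    rw [← f.flux_eq (Ioo_subset_Icc_self hy), h y hy]
  have h5 := h3.unique ((hasDerivAt_const x (0 : ℝ)).congr_of_eventuallyEq h4)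
  rw [h2, Pi.zero_apply]
  linarith

theorem isCompactPositive_green : IsCompactPositive green where
  compact := isCompactOperator_green
  symm f g := by
    rw [real_inner_comm (green g), inner_green, inner_green, mul_comm (mean f)]
    simp only [mul_comm (flux f _)]
  nonneg f := by
    rw [inner_green]
    have := f.integral_flux_sq_nonneg
    nlinarith [mul_self_nonneg (mean f)]
  -- If `green f = 0`, the quadratic form vanishes, hence so do the mean and the flux of `f`;
  -- differentiating the flux gives `f = 0`.
  injective f hf := by
    have h1 := f.inner_green f
    rw [hf, inner_zero_left] at h1
    have h2 := f.integral_flux_sq_nonneg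
    have hm : mean f = 0 := by nlinarith [mul_self_nonneg (mean f)]
    rw [hm, mul_zero, mul_zero, add_zero] at h1
    refine f.eq_zero_of_flux hm fun x hx => ?_
    have hint : Integrable (fun x => flux f x * flux f x / (1 - x ^ 2)) unitMeasure := by
      have h3 := f.intervalIntegrable_flux_div.continuousOn_mul (g := flux f)
        (by rw [uIcc_of_le (by norm_num)]; exact f.continuousOn_flux)
      rw [intervalIntegrable_iff_integrableOn_Ioo_of_le (by norm_num)] at h3
      simp only [mul_div_assoc]
      exact h3
    rw [← integral_unitMeasure] at h1
    have h4 := (integral_eq_zero_iff_of_nonneg_ae (by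
      filter_upwards [ae_mem_Ioo] with y hy
      exact f.flux_sq_div_nonneg (Ioo_subset_Icc_self hy)) hint).1 h1.symm
    have h5 : flux f =ᵐ[unitMeasure] fun _ => 0 := by
      filter_upwards [h4, ae_mem_Ioo] with y hy hym
      have := (div_eq_zero_iff.1 hy).resolve_right (one_sub_sq_pos hym).ne'
      simpa using this
    exact Measure.eqOn_open_of_ae_eq h5 isOpen_Ioo (f.continuousOn_flux.mono Ioo_subset_Icc_self)
      continuousOn_const hx

theorem not_finiteDimensional : ¬ FiniteDimensional ℝ L2Unit := by
  intro hfin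
  set s : ℕ → Set ℝ := fun k => Ioo (1 / ((k : ℝ) + 2)) (1 / ((k : ℝ) + 1)) with hs
  set v : ℕ → L2Unit := fun k =>
    indicatorConstLp 2 (measurableSet_Ioo : MeasurableSet (s k)) (measure_ne_top _ _) 1 with hv
  have hinner : ∀ i j, ⟪v i, v j⟫_ℝ = unitMeasure.real (s i ∩ s j) := fun i j =>
    L2.real_inner_indicatorConstLp_one_indicatorConstLp_one _ _ _ _
  have hlin : LinearIndependent ℝ v := by
    refine linearIndependent_of_ne_zero_of_inner_eq_zero (𝕜 := ℝ) (fun i h => ?_) fun i j hij => ?_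
    · have h1 := hinner i i
      have hlt : 1 / ((i : ℝ) + 2) < 1 / ((i : ℝ) + 1) :=
        one_div_lt_one_div_of_lt (by positivity) (by linarith)
      have hsub : s i ∩ Ioo (-1 : ℝ) 1 = s i := by
        refine inter_eq_left.2 (Ioo_subset_Ioo ?_ ?_)
        · have : (0 : ℝ) < 1 / ((i : ℝ) + 2) := by positivity
          linarith
        · rw [div_le_one (by positivity)]
          have : (0 : ℝ) ≤ i := by positivity
          linarith
      rw [h, inner_zero_left, inter_self, measureReal_restrict_apply measurableSet_Ioo, hsub,
        Real.volume_real_Ioo_of_le hlt.le] at h1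
      linarith
    · refine (hinner i j).trans ?_
      have : s i ∩ s j = ∅ := by
        wlog hlt : i < j generalizing i j
        · rw [inter_comm]
          exact this j i hij.symm (by lia)
        ext x
        simp only [hs, mem_inter_iff, mem_Ioo, mem_empty_iff_false, iff_false, not_and, and_imp]
        intro h1 _ _ h4
        have h5 : (i : ℝ) + 2 ≤ j + 1 := by exact_mod_cast (by lia : i + 2 ≤ j + 1)
        have h6 := one_div_le_one_div_of_le (by positivity) h5
        linarith
      rw [this]; simp
  have := hlin.finite
  exact not_finite ℕ

end L2Unit

/-! ### Potentials, and the boundary value problem as a resolvent equation -/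

/-- `p` is bounded on `(-1, 1)` and continuous there off the finite set `X`. -/
structure IsPotential (X : Set ℝ) (p : ℝ → ℝ) : Prop where
  finite : X.Finite
  bounded : ∃ C, ∀ x ∈ Ioo (-1 : ℝ) 1, |p x| ≤ C
  continuousAt : ∀ x ∈ Ioo (-1 : ℝ) 1, x ∉ X → ContinuousAt p x

theorem aestronglyMeasurable_of_continuousAt {X : Set ℝ} (hX : X.Finite) {p : ℝ → ℝ}
    (hp : ∀ x ∈ Ioo (-1 : ℝ) 1, x ∉ X → ContinuousAt p x) :
    AEStronglyMeasurable p unitMeasure := by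
  have h1 : ContinuousOn p (Ioo (-1 : ℝ) 1 \ X) := fun x hx =>
    (hp x hx.1 hx.2).continuousWithinAt
  have h2 := h1.aestronglyMeasurable (μ := volume) (measurableSet_Ioo.diff hX.measurableSet)
  rwa [Measure.restrict_congr_set (sdiff_null_ae_eq_self (hX.measure_zero volume))] at h2

namespace L2Unit

/-- `T` is the operator of multiplication by `p`. -/
def IsMulOp (T : L2Unit →L[ℝ] L2Unit) (p : ℝ → ℝ) : Prop :=
  ∀ f, T f =ᵐ[unitMeasure] fun x => p x * f x

theorem exists_isMulOp {p : ℝ → ℝ} (hp : AEStronglyMeasurable p unitMeasure) {C : ℝ}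
    (hC : ∀ x ∈ Ioo (-1 : ℝ) 1, |p x| ≤ C) : ∃ T, IsMulOp T p := by
  have hmem : ∀ f : L2Unit, MemLp (fun x => p x * f x) 2 unitMeasure := fun f => by
    refine (Lp.memLp f).of_le_mul (c := C) (hp.mul (Lp.aestronglyMeasurable f)) ?_
    filter_upwards [ae_mem_Ioo] with x hx
    rw [norm_mul]
    exact mul_le_mul_of_nonneg_right (hC x hx) (norm_nonneg _)
  have hae : ∀ f : L2Unit, (hmem f).toLp =ᵐ[unitMeasure] fun x => p x * f x := fun f =>
    (hmem f).coeFn_toLp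
  refine ⟨LinearMap.mkContinuous
    { toFun := fun f => (hmem f).toLp
      map_add' := fun f g => Lp.ext ?_
      map_smul' := fun c f => Lp.ext ?_ } C fun f => ?_, hae⟩
  · filter_upwards [hae (f + g), hae f, hae g, Lp.coeFn_add f g,
      Lp.coeFn_add (hmem f).toLp (hmem g).toLp] with x h1 h2 h3 h4 h5
    rw [h1, h5, Pi.add_apply, h2, h3, h4, Pi.add_apply]; ring
  · filter_upwards [hae (c • f), hae f, Lp.coeFn_smul c f,
      Lp.coeFn_smul c (hmem f).toLp] with x h1 h2 h3 h4
    rw [h1, RingHom.id_apply, h4, Pi.smul_apply, h2, h3, Pi.smul_apply, smul_eq_mul, smul_eq_mul]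
    ring
  · refine Lp.norm_le_mul_norm_of_ae_le_mul ?_
    filter_upwards [hae f, ae_mem_Ioo] with x h1 hx
    refine (congrArg norm h1).trans_le ?_
    rw [norm_mul]
    exact mul_le_mul_of_nonneg_right (hC x hx) (norm_nonneg _)

theorem _root_.IsPotential.exists_isMulOp {X : Set ℝ} {p : ℝ → ℝ} (hp : IsPotential X p) :
    ∃ T, IsMulOp T p :=
  let ⟨_, hC⟩ := hp.bounded
  L2Unit.exists_isMulOp (aestronglyMeasurable_of_continuousAt hp.finite hp.continuousAt) hC

theorem IsMulOp.symm {T : L2Unit →L[ℝ] L2Unit} {p : ℝ → ℝ} (hT : IsMulOp T p) (f g : L2Unit) :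
    ⟪T f, g⟫_ℝ = ⟪f, T g⟫_ℝ := by
  rw [L2.inner_def, L2.inner_def]
  refine integral_congr_ae ?_
  filter_upwards [hT f, hT g] with x h1 h2
  rw [h1, h2]
  simp only [RCLike.inner_apply, conj_trivial]
  ring

theorem IsMulOp.norm_le {T : L2Unit →L[ℝ] L2Unit} {p : ℝ → ℝ} (hT : IsMulOp T p) {C : ℝ}
    (hC : ∀ x ∈ Ioo (-1 : ℝ) 1, |p x| ≤ C) (f : L2Unit) : ‖T f‖ ≤ C * ‖f‖ := by
  refine Lp.norm_le_mul_norm_of_ae_le_mul ?_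
  filter_upwards [hT f, ae_mem_Ioo] with x h1 hx
  rw [h1, norm_mul]
  exact mul_le_mul_of_nonneg_right (hC x hx) (norm_nonneg _)

theorem IsMulOp.sub {T S : L2Unit →L[ℝ] L2Unit} {p r : ℝ → ℝ} (hT : IsMulOp T p)
    (hS : IsMulOp S r) : IsMulOp (T - S) (fun x => p x - r x) := fun f => by
  filter_upwards [hT f, hS f, Lp.coeFn_sub (T f) (S f)] with x h1 h2 h3
  rw [sub_apply, h3, Pi.sub_apply, h1, h2]; ring

/-- The continuous representative of `green h`. -/
noncomputable def greenRep (h : L2Unit) (x : ℝ) : ℝ := pot h x + (mean h - mean (potCLM h))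

theorem add_smul_one_ae (f : L2Unit) (c : ℝ) :
    (f + c • one : L2Unit) =ᵐ[unitMeasure] fun x => f x + c := by
  filter_upwards [Lp.coeFn_add f (c • one), Lp.coeFn_smul c one, one_ae] with x h1 h2 h3
  rw [h1, Pi.add_apply, h2, Pi.smul_apply, h3, smul_eq_mul, mul_one]

theorem green_eq (h : L2Unit) : green h = potCLM h + (mean h - mean (potCLM h)) • one := by
  rw [green_apply]; module

theorem green_ae (h : L2Unit) : green h =ᵐ[unitMeasure] greenRep h := by
  rw [green_eq]
  filter_upwards [add_smul_one_ae (potCLM h) (mean h - mean (potCLM h)), potCLM_ae h] with x h1 h2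
  rw [h1, h2, greenRep]

theorem hasDerivAt_greenRep (h : L2Unit) {x : ℝ} (hx : x ∈ Ioo (-1 : ℝ) 1) :
    HasDerivAt (greenRep h) (-(flux h x / (1 - x ^ 2))) x :=
  (h.hasDerivAt_pot hx).add_const _

theorem mul_deriv_greenRep (h : L2Unit) {x : ℝ} (hx : x ∈ Ioo (-1 : ℝ) 1) :
    (1 - x ^ 2) * deriv (greenRep h) x = -flux h x := by
  rw [(h.hasDerivAt_greenRep hx).deriv]
  have := (one_sub_sq_pos hx).ne'
  field_simp

theorem continuousOn_greenRep (h : L2Unit) : ContinuousOn (greenRep h) (Icc (-1) 1) :=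
  h.continuousOn_pot.add continuousOn_const

theorem hasDerivAt_flux (h : L2Unit) {h₀ : ℝ → ℝ} (hae : h =ᵐ[unitMeasure] h₀) {x : ℝ}
    (hx : x ∈ Ioo (-1 : ℝ) 1) (hc : ContinuousAt h₀ x) :
    HasDerivAt (flux h) (h₀ x - mean h) x := by
  have hint : IntervalIntegrable (fun t => h₀ t - mean h) volume (-1) 1 :=
    (intervalIntegrable_of_unitMeasure (h.integrable.congr hae)).sub (by simp)
  have h1 : HasDerivAt (fun y => ∫ t in (-1 : ℝ)..y, (h₀ t - mean h)) (h₀ x - mean h) x := by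
    refine intervalIntegral.integral_hasDerivAt_right
      (intervalIntegrable_sub_interval hint (by simp) (Ioo_subset_Icc_self hx))
      ⟨Ioo (-1) 1, isOpen_Ioo.mem_nhds hx, ?_⟩ (hc.sub continuousAt_const)
    exact (h.integrable.congr hae).aestronglyMeasurable.sub aestronglyMeasurable_const
  refine h1.congr_of_eventuallyEq ?_
  filter_upwards [isOpen_Ioo.mem_nhds hx] with y hy
  rw [h.flux_eq (Ioo_subset_Icc_self hy)]
  have hae' := (ae_restrict_iff' measurableSet_Ioo).1 hae
  have hne : ∀ᵐ x : ℝ, x ≠ 1 := by simp [ae_iff, measure_singleton]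
  refine intervalIntegral.integral_congr_ae ?_
  filter_upwards [hae'] with t ht hty
  rw [uIoc_of_le hy.1.le] at hty
  rw [ht ⟨hty.1, hty.2.trans_lt hy.2⟩]

theorem tendsto_left {ψ : ℝ → ℝ} (h : ContinuousOn ψ (Icc (-1) 1)) :
    Tendsto ψ (𝓝[>] (-1)) (𝓝 (ψ (-1))) := by
  rw [← nhdsWithin_Ioo_eq_nhdsGT (show (-1 : ℝ) < 1 by norm_num)]
  exact (h (-1) (by simp)).mono Ioo_subset_Icc_self

theorem tendsto_right {ψ : ℝ → ℝ} (h : ContinuousOn ψ (Icc (-1) 1)) :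
    Tendsto ψ (𝓝[<] 1) (𝓝 (ψ 1)) := by
  rw [← nhdsWithin_Ioo_eq_nhdsLT (show (-1 : ℝ) < 1 by norm_num)]
  exact (h 1 (by simp)).mono Ioo_subset_Icc_self

variable {X : Set ℝ} {p F u : ℝ → ℝ} {lam : ℝ} {T : L2Unit →L[ℝ] L2Unit} {f g : L2Unit}

theorem resolvent_source_ae (hT : IsMulOp T p) (hu : f =ᵐ[unitMeasure] u)
    (hg : g =ᵐ[unitMeasure] fun x => -F x) :
    (lam • f - T f + g : L2Unit) =ᵐ[unitMeasure] fun x => -(F x - (lam - p x) * u x) := by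
  filter_upwards [Lp.coeFn_add (lam • f - T f) g, Lp.coeFn_sub (lam • f) (T f),
    Lp.coeFn_smul lam f, hT f, hu, hg] with x h1 h2 h3 h4 h5 h6
  rw [h1, Pi.add_apply, h2, Pi.sub_apply, h3, Pi.smul_apply, h4, h5, h6, smul_eq_mul]
  ring

/-- The operator inverted by `green` contains the mean, so the bounded part has to be `T - meanCLM`.
This isolates the compensating constant. -/
theorem source_eq (lam : ℝ) (f g : L2Unit) :
    lam • f - (T - meanCLM) f + g = (lam • f - T f + g) + mean f • one := by
  rw [sub_apply, meanCLM_apply]; abel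

/-- Solutions of the resolvent equation have representatives that solve the boundary value
problem. -/
theorem solvesBVP_of_resolventEq (hT : IsMulOp T p) (hp : IsPotential X p)
    (hF : ∀ x ∈ Ioo (-1 : ℝ) 1, x ∉ X → ContinuousAt F x)
    (hg : g =ᵐ[unitMeasure] fun x => -F x) (hf : ResolventEq green (T - meanCLM) lam g f) :
    f =ᵐ[unitMeasure] greenRep (lam • f - (T - meanCLM) f + g) ∧
      SolvesBVP X p lam F (greenRep (lam • f - (T - meanCLM) f + g)) := by
  set h := lam • f - (T - meanCLM) f + g with hh
  have hfg : green h = f := hf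
  have hae : f =ᵐ[unitMeasure] greenRep h := by
    have := green_ae h
    rwa [hfg] at this
  refine ⟨hae, ?_⟩
  have hdiff : ∀ x ∈ Ioo (-1 : ℝ) 1, DifferentiableAt ℝ (greenRep h) x := fun x hx =>
    (h.hasDerivAt_greenRep hx).differentiableAt
  have hwflux : ∀ x ∈ Ioo (-1 : ℝ) 1, (1 - x ^ 2) * deriv (greenRep h) x = -flux h x :=
    fun x hx => h.mul_deriv_greenRep hx
  refine ⟨hdiff, ?_, fun x hx hxX => ?_, ?_, ?_, ?_⟩
  · exact h.continuousOn_flux_div.neg.congr fun x hx => (h.hasDerivAt_greenRep hx).deriv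
  · have hmean : mean h = mean f := by rw [← hfg, mean_green]
    have hsrc : h =ᵐ[unitMeasure] fun x => -(F x - (lam - p x) * greenRep h x) + mean f := by
      rw [hh, source_eq]
      filter_upwards [add_smul_one_ae (lam • f - T f + g) (mean f),
        resolvent_source_ae (lam := lam) hT hae hg] with x h1 h2
      rw [h1, h2, ← source_eq]
    have hc : ContinuousAt (fun x => -(F x - (lam - p x) * greenRep h x) + mean f) x :=
      ((hF x hx hxX).sub ((continuousAt_const.sub (hp.continuousAt x hx hxX)).mul
        (hdiff x hx).continuousAt)).neg.add continuousAt_const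
    have h1 := (h.hasDerivAt_flux hsrc hx hc).neg
    have h2 := h1.congr_of_eventuallyEq (f₁ := fun y => (1 - y ^ 2) * deriv (greenRep h) y) (by
      filter_upwards [isOpen_Ioo.mem_nhds hx] with y hy using hwflux y hy)
    refine h2.congr_deriv ?_
    rw [hmean]; ring
  · have h1 := (tendsto_left h.continuousOn_flux).neg
    rw [flux_neg_one, neg_zero] at h1
    refine h1.congr' ?_
    filter_upwards [Ioo_mem_nhdsGT (show (-1 : ℝ) < 1 by norm_num)] with x hx
    exact (hwflux x hx).symm
  · have h1 := (tendsto_right h.continuousOn_flux).neg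
    rw [flux_one_right, neg_zero] at h1
    refine h1.congr' ?_
    filter_upwards [Ioo_mem_nhdsLT (show (-1 : ℝ) < 1 by norm_num)] with x hx
    exact (hwflux x hx).symm
  · exact (memLp_congr_ae hae).1 (Lp.memLp f)

/-- Solutions of the boundary value problem solve the resolvent equation. -/
theorem resolventEq_of_solvesBVP (hT : IsMulOp T p) (hX : X.Finite)
    (hu : SolvesBVP X p lam F u) (hg : g =ᵐ[unitMeasure] fun x => -F x)
    (hf : f =ᵐ[unitMeasure] u) : ResolventEq green (T - meanCLM) lam g f := by
  set k := lam • f - T f + g with hk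
  set G : ℝ → ℝ := fun x => F x - (lam - p x) * u x with hG
  have hkG : k =ᵐ[unitMeasure] fun x => -G x := resolvent_source_ae hT hf hg
  have hGint : IntervalIntegrable G volume (-1) 1 := by
    refine intervalIntegrable_of_unitMeasure (k.integrable.neg.congr ?_)
    filter_upwards [hkG] with x hx
    rw [Pi.neg_apply, hx, neg_neg]
  set w : ℝ → ℝ := fun x => (1 - x ^ 2) * deriv u x with hw
  have hwc : ContinuousOn w (Ioo (-1) 1) :=
    (by fun_prop : ContinuousOn (fun x : ℝ => 1 - x ^ 2) (Ioo (-1) 1)).mul hu.continuous_deriv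
  set P : ℝ → ℝ := fun x => ∫ t in (-1 : ℝ)..x, G t with hP
  have hPc : ContinuousOn P (Icc (-1) 1) := by
    have h := intervalIntegral.continuousOn_primitive_interval' hGint (a := -1) (by simp)
    rwa [uIcc_of_le (by norm_num)] at h
  have h0 : (0 : ℝ) ∈ Ioo (-1 : ℝ) 1 := by constructor <;> norm_num
  have hmem : (-1 : ℝ) ∈ Icc (-1 : ℝ) 1 := by simp
  have hwP : ∀ x ∈ Ioo (-1 : ℝ) 1, w x = P x + (w 0 - P 0) := by
    intro x hx
    have hsub : uIcc 0 x ⊆ Ioo (-1 : ℝ) 1 := (convex_Ioo _ _).ordConnected.uIcc_subset h0 hx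
    have h1 := integral_eq_of_hasDerivAt_off_countable w G hX.countable (a := 0) (b := x)
      (hwc.mono hsub) (fun y hy => hu.equation y (hsub (Ioo_subset_Icc_self hy.1)) hy.2)
      (intervalIntegrable_sub_interval hGint (Ioo_subset_Icc_self h0) (Ioo_subset_Icc_self hx))
    have h2 := intervalIntegral.integral_interval_sub_left
      (intervalIntegrable_sub_interval hGint hmem (Ioo_subset_Icc_self hx))
      (intervalIntegrable_sub_interval hGint hmem (Ioo_subset_Icc_self h0))
    simp only [hP]
    linarith
  have hPm : P (-1) = 0 := intervalIntegral.integral_same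
  -- The left boundary condition fixes the integration constant. The right one then gives `P 1 = 0`,
  -- that is, mean zero of the source `k`.
  have hconst : w 0 - P 0 = 0 := by
    have h1 : Tendsto w (𝓝[>] (-1)) (𝓝 (P (-1) + (w 0 - P 0))) := by
      refine ((tendsto_left hPc).add_const _).congr' ?_
      filter_upwards [Ioo_mem_nhdsGT (show (-1 : ℝ) < 1 by norm_num)] with x hx
      exact (hwP x hx).symm
    have := tendsto_nhds_unique h1 hu.boundary_left
    rwa [hPm, zero_add] at this
  have hP1 : P 1 = 0 := by
    have h1 : Tendsto w (𝓝[<] 1) (𝓝 (P 1)) := by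
      refine (tendsto_right hPc).congr' ?_
      filter_upwards [Ioo_mem_nhdsLT (show (-1 : ℝ) < 1 by norm_num)] with x hx
      rw [hwP x hx, hconst, add_zero]
    exact tendsto_nhds_unique h1 hu.boundary_right
  have hkint : ∀ x ∈ Icc (-1 : ℝ) 1, ∫ t in (-1 : ℝ)..x, k t = -P x := by
    intro x hx
    rw [hP, ← intervalIntegral.integral_neg]
    refine intervalIntegral.integral_congr_ae ?_
    have hne : ∀ᵐ x : ℝ, x ≠ 1 := by simp [ae_iff, measure_singleton]
    filter_upwards [(ae_restrict_iff' measurableSet_Ioo).1 hkG, hne] with t ht ht1 htx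
    rw [uIoc_of_le hx.1] at htx
    exact ht ⟨htx.1, lt_of_le_of_ne (htx.2.trans hx.2) ht1⟩
  have hmean : mean k = 0 := by rw [mean_eq, hkint 1 (by simp), hP1]; simp
  have hflux : ∀ x ∈ Ioo (-1 : ℝ) 1, flux k x = -w x := by
    intro x hx
    rw [flux_eq _ (Ioo_subset_Icc_self hx), hmean]
    simp only [sub_zero]
    rw [hkint x (Ioo_subset_Icc_self hx), hwP x hx, hconst, add_zero]
  -- Equal fluxes mean equal derivatives, so `u` and `pot k` differ by a constant, which the mean
  -- term in `green` recovers.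
  obtain ⟨c, hc⟩ := isOpen_Ioo.exists_is_const_of_deriv_eq_zero (𝕜 := ℝ)
    (f := fun x => u x - pot k x) (s := Ioo (-1 : ℝ) 1) isPreconnected_Ioo
    (fun x hx => ((hu.differentiable x hx).sub
      (k.hasDerivAt_pot hx).differentiableAt).differentiableWithinAt)
    (fun x hx => by
      have h1 := (hu.differentiable x hx).hasDerivAt.sub (k.hasDerivAt_pot hx)
      refine h1.deriv.trans ?_
      rw [hflux x hx, Pi.zero_apply]
      have := (one_sub_sq_pos hx).ne'
      simp only [hw]
      field_simp
      ring)
  have hfk : f = potCLM k + c • one := by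
    refine Lp.ext ?_
    filter_upwards [hf, add_smul_one_ae (potCLM k) c, potCLM_ae k, ae_mem_Ioo] with x h1 h2 h3 hx
    rw [h1, h2, h3, ← hc x hx]; ring
  unfold ResolventEq
  rw [source_eq, ← hk, map_add, map_smul, green_eq, green_eq, potCLM_one, hmean, mean_one]
  conv_rhs => rw [hfk]
  have hmf : mean f = mean (potCLM k) + c := by
    conv_lhs => rw [hfk]
    rw [mean_add, mean_smul, mean_one, mul_one]
  have hm0 : mean 0 = 0 := by simp [mean]
  rw [hmf, hm0]
  module

end L2Unit

/-! ### Uniqueness for the initial value problem and simplicity of eigenvalues -/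

/-- Induction on the exceptional set: the interval is cut at the new point, and continuity joins the
two halves. -/
theorem le_of_hasDerivAt_nonpos_off_finite {X : Set ℝ} (hX : X.Finite) {f f' : ℝ → ℝ} {a b : ℝ}
    (hab : a ≤ b) (hc : ContinuousOn f (Icc a b))
    (hd : ∀ x ∈ Ioo a b, x ∉ X → HasDerivAt f (f' x) x)
    (hn : ∀ x ∈ Ioo a b, x ∉ X → f' x ≤ 0) : f b ≤ f a := by
  induction X, hX using Set.Finite.induction_on generalizing a b with
  | empty =>
    have h : AntitoneOn f (Icc a b) := by
      refine antitoneOn_of_deriv_nonpos (convex_Icc a b) hc ?_ ?_ <;> rw [interior_Icc]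
      · exact fun x hx => (hd x hx (by simp)).differentiableAt.differentiableWithinAt
      · intro x hx
        rw [(hd x hx (by simp)).deriv]
        exact hn x hx (by simp)
    exact h (left_mem_Icc.2 hab) (right_mem_Icc.2 hab) hab
  | @insert y s _ _ ih =>
    have key : ∀ {c d : ℝ}, a ≤ c → c ≤ d → d ≤ b → y ∉ Ioo c d → f d ≤ f c := by
      intro c d hac hcd hdb hy
      have hne : ∀ x ∈ Ioo c d, x ∉ s → x ∈ Ioo a b ∧ x ∉ insert y s := fun x hx hxs =>
        ⟨⟨hac.trans_lt hx.1, hx.2.trans_le hdb⟩, fun h => (mem_insert_iff.1 h).elim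
          (fun h => hy (h ▸ hx)) hxs⟩
      exact ih hcd (hc.mono (Icc_subset_Icc hac hdb))
        (fun x hx hxs => hd x (hne x hx hxs).1 (hne x hx hxs).2)
        (fun x hx hxs => hn x (hne x hx hxs).1 (hne x hx hxs).2)
    by_cases hy : y ∈ Ioo a b
    · exact (key hy.1.le hy.2.le le_rfl (by simp)).trans (key le_rfl hy.1.le hy.2.le (by simp))
    · exact key le_rfl hab le_rfl hy

/-- Gronwall's inequality with finitely many exceptional points, in both directions. -/
theorem eq_zero_iff_of_abs_deriv_le {X : Set ℝ} (hX : X.Finite) {E E' : ℝ → ℝ} {a b K : ℝ}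
    (hab : a ≤ b) (hc : ContinuousOn E (Icc a b)) (hE : ∀ x, 0 ≤ E x)
    (hd : ∀ x ∈ Ioo a b, x ∉ X → HasDerivAt E (E' x) x)
    (hn : ∀ x ∈ Ioo a b, x ∉ X → |E' x| ≤ K * E x) : E a = 0 ↔ E b = 0 := by
  have hexp : ∀ c x : ℝ, HasDerivAt (fun y => Real.exp (c * y)) (Real.exp (c * x) * c) x :=
    fun c x => by simpa using ((hasDerivAt_id x).const_mul c).exp
  have hexpc : ∀ c : ℝ, Continuous fun y => Real.exp (c * y) := fun c => by fun_prop
  constructor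
  · intro h
    have h1 := le_of_hasDerivAt_nonpos_off_finite hX hab (f := fun x => E x * Real.exp (-K * x))
      (hc.mul (hexpc (-K)).continuousOn) (fun x hx hxX => (hd x hx hxX).mul (hexp (-K) x))
      (fun x hx hxX => by
        have h2 := (abs_le.1 (hn x hx hxX)).2
        have h3 := Real.exp_pos (-K * x)
        nlinarith)
    simp only [h, zero_mul] at h1
    exact le_antisymm (nonpos_of_mul_nonpos_left h1 (Real.exp_pos _)) (hE b)
  · intro h
    have h1 := le_of_hasDerivAt_nonpos_off_finite hX hab
      (f := fun x => -(E x * Real.exp (K * x)))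
      (hc.mul (hexpc K).continuousOn).neg
      (fun x hx hxX => ((hd x hx hxX).mul (hexp K x)).neg)
      (fun x hx hxX => by
        have h2 := (abs_le.1 (hn x hx hxX)).1
        have h3 := Real.exp_pos (K * x)
        nlinarith)
    simp only [h, zero_mul, neg_zero] at h1
    exact le_antisymm (nonpos_of_mul_nonpos_left (neg_nonneg.1 h1) (Real.exp_pos _)) (hE a)

variable {X : Set ℝ} {p u v : ℝ → ℝ} {l : ℝ}

theorem SolvesBVP.continuousOn {F : ℝ → ℝ} (hu : SolvesBVP X p l F u) :
    ContinuousOn u (Ioo (-1) 1) :=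
  fun x hx => (hu.differentiable x hx).continuousAt.continuousWithinAt

theorem SolvesBVP.continuousOn_flux {F : ℝ → ℝ} (hu : SolvesBVP X p l F u) :
    ContinuousOn (fun x => (1 - x ^ 2) * deriv u x) (Ioo (-1) 1) :=
  (by fun_prop : ContinuousOn (fun x : ℝ => 1 - x ^ 2) (Ioo (-1) 1)).mul hu.continuous_deriv

/-- Uniqueness for the initial value problem. -/
theorem SolvesBVP.eq_zero_of_initial (hp : IsPotential X p)
    (hd : ∀ x ∈ Ioo (-1 : ℝ) 1, DifferentiableAt ℝ u x)
    (hdc : ContinuousOn (deriv u) (Ioo (-1) 1))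
    (he : ∀ x ∈ Ioo (-1 : ℝ) 1, x ∉ X →
      HasDerivAt (fun y => (1 - y ^ 2) * deriv u y) (-(l - p x) * u x) x)
    {x₀ : ℝ} (hx₀ : x₀ ∈ Ioo (-1 : ℝ) 1) (h0 : u x₀ = 0) (h1 : deriv u x₀ = 0) :
    ∀ x ∈ Ioo (-1 : ℝ) 1, u x = 0 := by
  obtain ⟨C, hC⟩ := hp.bounded
  set w : ℝ → ℝ := fun x => (1 - x ^ 2) * deriv u x with hw
  -- With the flux `w` in place of `u'` the equation is a linear first-order system, so on compact
  -- subintervals `|E'|` is at most a constant times `E`.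
  set E : ℝ → ℝ := fun x => u x ^ 2 + w x ^ 2 with hE
  have huc : ContinuousOn u (Ioo (-1) 1) :=
    fun x hx => (hd x hx).continuousAt.continuousWithinAt
  have hwc : ContinuousOn w (Ioo (-1) 1) :=
    (by fun_prop : ContinuousOn (fun x : ℝ => 1 - x ^ 2) (Ioo (-1) 1)).mul hdc
  have hEc : ContinuousOn E (Ioo (-1) 1) := (huc.pow 2).add (hwc.pow 2)
  have key : ∀ a ∈ Ioo (-1 : ℝ) 1, ∀ b ∈ Ioo (-1 : ℝ) 1, a ≤ b → (E a = 0 ↔ E b = 0) := by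
    intro a ha b hb hab
    have hsub : Icc a b ⊆ Ioo (-1 : ℝ) 1 := fun x hx =>
      ⟨ha.1.trans_le hx.1, hx.2.trans_lt hb.2⟩
    obtain ⟨A, hA⟩ := isCompact_Icc.exists_bound_of_continuousOn
      (f := fun x : ℝ => (1 - x ^ 2)⁻¹) (s := Icc a b)
      (ContinuousOn.inv₀ (by fun_prop) fun x hx => (L2Unit.one_sub_sq_pos (hsub hx)).ne')
    refine eq_zero_iff_of_abs_deriv_le hp.finite hab (hEc.mono hsub)
      (fun x => by positivity) (K := A + (|l| + C))
      (E' := fun x => 2 * u x * deriv u x + 2 * w x * (-(l - p x) * u x))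
      (fun x hx hxX => ?_) (fun x hx hxX => ?_)
    · have hxm := hsub (Ioo_subset_Icc_self hx)
      have h2 := ((hd x hxm).hasDerivAt.pow 2).add ((he x hxm hxX).pow 2)
      refine h2.congr_deriv ?_
      simp only [hw]
      push_cast
      ring
    · have hxI := Ioo_subset_Icc_self hx
      have hxm := hsub hxI
      have hpos := L2Unit.one_sub_sq_pos hxm
      have h2 : deriv u x = (1 - x ^ 2)⁻¹ * w x := by simp only [hw]; field_simp
      have h3 : |(1 - x ^ 2)⁻¹| ≤ A := hA x hxI
      have h4 : |l - p x| ≤ |l| + C := (abs_sub _ _).trans (add_le_add_right (hC x hxm) _)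
      have h5 : 2 * |u x * w x| ≤ E x := by
        rw [abs_mul]
        simp only [hE]
        rw [← sq_abs (u x), ← sq_abs (w x)]
        nlinarith [sq_nonneg (|u x| - |w x|)]
      have h6 : 2 * u x * deriv u x + 2 * w x * (-(l - p x) * u x) =
          ((1 - x ^ 2)⁻¹ - (l - p x)) * (2 * (u x * w x)) := by rw [h2]; ring
      rw [h6, abs_mul, abs_mul, abs_two]
      refine mul_le_mul ((abs_sub _ _).trans (add_le_add h3 h4)) h5 (by positivity) ?_
      have := (abs_nonneg _).trans h3
      have := (abs_nonneg _).trans h4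
      linarith
  have hE0 : E x₀ = 0 := by simp only [hE, hw]; rw [h0, h1]; ring
  intro x hx
  have hEx : E x = 0 := by
    rcases le_total x x₀ with h | h
    · exact (key x hx x₀ hx₀ h).2 hE0
    · exact (key x₀ hx₀ x hx h).1 hE0
  have : u x ^ 2 = 0 := by
    simp only [hE] at hEx
    nlinarith [sq_nonneg (u x), sq_nonneg (w x)]
  exact pow_eq_zero_iff two_ne_zero |>.1 this

/-- The Wronskian of two solutions vanishes if both solutions have a limit at `-1`. -/
theorem SolvesBVP.wronskian_eq_zero (hX : X.Finite) (hu : SolvesBVP X p l (fun _ => 0) u)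
    (hv : SolvesBVP X p l (fun _ => 0) v) {cu cv : ℝ} (hul : Tendsto u (𝓝[>] (-1)) (𝓝 cu))
    (hvl : Tendsto v (𝓝[>] (-1)) (𝓝 cv)) :
    ∀ x ∈ Ioo (-1 : ℝ) 1, u x * deriv v x = v x * deriv u x := by
  set Z : ℝ → ℝ := fun x =>
    u x * ((1 - x ^ 2) * deriv v x) - v x * ((1 - x ^ 2) * deriv u x) with hZ
  have hZc : ContinuousOn Z (Ioo (-1) 1) :=
    (hu.continuousOn.mul hv.continuousOn_flux).sub (hv.continuousOn.mul hu.continuousOn_flux)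
  have h0 : (0 : ℝ) ∈ Ioo (-1 : ℝ) 1 := by constructor <;> norm_num
  have hconst : ∀ x ∈ Ioo (-1 : ℝ) 1, Z x = Z 0 := by
    intro x hx
    have hsub : uIcc 0 x ⊆ Ioo (-1 : ℝ) 1 := (convex_Ioo _ _).ordConnected.uIcc_subset h0 hx
    have h1 := integral_eq_of_hasDerivAt_off_countable Z (fun _ => 0) hX.countable
      (a := 0) (b := x) (hZc.mono hsub) (fun y hy => by
        have hym := hsub (Ioo_subset_Icc_self hy.1)
        have h2 := ((hu.differentiable y hym).hasDerivAt.mul (hv.equation y hym hy.2)).sub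
          ((hv.differentiable y hym).hasDerivAt.mul (hu.equation y hym hy.2))
        refine h2.congr_deriv ?_
        ring) (by simp)
    rw [intervalIntegral.integral_zero] at h1
    linarith
  -- The Wronskian weighted by `1 - x²` is constant, and at `-1` the fluxes vanish while the
  -- solutions stay bounded.
  have hlim : Tendsto Z (𝓝[>] (-1)) (𝓝 (cu * 0 - cv * 0)) :=
    (hul.mul hv.boundary_left).sub (hvl.mul hu.boundary_left)
  have hlim' : Tendsto Z (𝓝[>] (-1)) (𝓝 (Z 0)) := by
    refine tendsto_const_nhds.congr' ?_
    filter_upwards [Ioo_mem_nhdsGT (show (-1 : ℝ) < 1 by norm_num)] with x hx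
    exact (hconst x hx).symm
  have hZ0 : Z 0 = 0 := by simpa using tendsto_nhds_unique hlim' hlim
  intro x hx
  have h1 := (hconst x hx).trans hZ0
  have h2 := (L2Unit.one_sub_sq_pos hx).ne'
  have h3 : (1 - x ^ 2) * (u x * deriv v x - v x * deriv u x) = 0 := by
    rw [← h1]; simp only [hZ]; ring
  exact sub_eq_zero.1 ((mul_eq_zero.1 h3).resolve_left h2)

namespace L2Unit

/-- Eigenvalues are simple. -/
theorem eq_smul_of_resolventEq {T : L2Unit →L[ℝ] L2Unit} (hT : IsMulOp T p)
    (hp : IsPotential X p) {f g : L2Unit} (hf : ResolventEq green (T - meanCLM) l 0 f)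
    (hg : ResolventEq green (T - meanCLM) l 0 g) (hg0 : g ≠ 0) : ∃ c : ℝ, f = c • g := by
  have hz : ((0 : L2Unit) : ℝ → ℝ) =ᵐ[unitMeasure] fun x => -(fun _ : ℝ => (0 : ℝ)) x := by
    filter_upwards [Lp.coeFn_zero ℝ 2 unitMeasure] with x hx
    rw [hx]; simp
  obtain ⟨hfu, hu⟩ := solvesBVP_of_resolventEq hT hp (fun _ _ _ => continuousAt_const) hz hf
  obtain ⟨hgv, hv⟩ := solvesBVP_of_resolventEq hT hp (fun _ _ _ => continuousAt_const) hz hg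
  have hul := tendsto_left (continuousOn_greenRep (l • f - (T - meanCLM) f + 0))
  have hvl := tendsto_left (continuousOn_greenRep (l • g - (T - meanCLM) g + 0))
  set u := greenRep (l • f - (T - meanCLM) f + 0)
  set v := greenRep (l • g - (T - meanCLM) g + 0)
  have hW := hu.wronskian_eq_zero hp.finite hv hul hvl
  obtain ⟨x₀, hx₀, hvx⟩ : ∃ x ∈ Ioo (-1 : ℝ) 1, v x ≠ 0 := by
    by_contra! h
    refine hg0 (Lp.ext ?_)
    filter_upwards [hgv, Lp.coeFn_zero ℝ 2 unitMeasure, ae_mem_Ioo] with x h1 h2 hx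
    rw [h1, h2, h x hx, Pi.zero_apply]
  -- With this `c` the difference `u - c v` vanishes at `x₀`, and the vanishing Wronskian makes its
  -- derivative vanish there too.
  set c := u x₀ / v x₀ with hc
  have hdz : ∀ x ∈ Ioo (-1 : ℝ) 1, HasDerivAt (fun x => u x - c * v x)
      (deriv u x - c * deriv v x) x := fun x hx =>
    (hu.differentiable x hx).hasDerivAt.sub ((hv.differentiable x hx).hasDerivAt.const_mul c)
  have hzero := SolvesBVP.eq_zero_of_initial (l := l) (u := fun x => u x - c * v x) hp
    (fun x hx => (hdz x hx).differentiableAt)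
    ((hu.continuous_deriv.sub (hv.continuous_deriv.const_mul c)).congr fun x hx => (hdz x hx).deriv)
    (fun x hx hxX => by
      have h1 := (hu.equation x hx hxX).sub ((hv.equation x hx hxX).const_mul c)
      refine (h1.congr_of_eventuallyEq ?_).congr_deriv (by ring)
      filter_upwards [isOpen_Ioo.mem_nhds hx] with y hy
      rw [(hdz y hy).deriv, Pi.sub_apply]
      ring) hx₀ (by rw [hc]; field_simp; ring) (by
      rw [(hdz x₀ hx₀).deriv, hc]
      have := hW x₀ hx₀
      field_simp
      linarith)
  refine ⟨c, Lp.ext ?_⟩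
  filter_upwards [hfu, hgv, Lp.coeFn_smul c g, ae_mem_Ioo] with x h1 h2 h3 hx
  rw [h1, h3, Pi.smul_apply, h2, smul_eq_mul]
  linarith [hzero x hx]

end L2Unit

/-! ### Wallis bounds and tails of the majorant series -/

section Tails

/-- Transfers the two-sided bounds on Wallis' product to central binomial coefficients. -/
theorem sq_div_centralBinom (k : ℕ) :
    (4 ^ k / (k.centralBinom : ℝ)) ^ 2 = Real.Wallis.W k * (2 * k + 1) := by
  have h1 : (k.centralBinom : ℝ) * ((k ! : ℝ) * (k ! : ℝ)) = ((2 * k)! : ℝ) := by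
    have h := Nat.choose_mul_factorial_mul_factorial (show k ≤ 2 * k by lia)
    rw [show 2 * k - k = k by lia, mul_assoc] at h
    exact_mod_cast h
  have h2 : (k ! : ℝ) ≠ 0 := by exact_mod_cast k.factorial_ne_zero
  have h3 : (k.centralBinom : ℝ) ≠ 0 := by exact_mod_cast k.centralBinom_ne_zero
  have h5 : (2 * (k : ℝ) + 1) ≠ 0 := by positivity
  rw [Real.Wallis.W_eq_factorial_ratio, ← h1, pow_mul]
  field_simp
  rw [← pow_mul, mul_comm k 2, pow_mul]
  norm_num

theorem sqrt_pi_mul_le (k : ℕ) : √(Real.pi * k) ≤ 4 ^ k / (k.centralBinom : ℝ) := by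
  refine Real.sqrt_le_iff.2 ⟨by positivity, ?_⟩
  rw [sq_div_centralBinom]
  have h1 := Real.Wallis.le_W k
  have h2 : Real.pi * k ≤ (2 * k + 1) / (2 * k + 2) * (Real.pi / 2) * (2 * k + 1) := by
    have h3 : ((2 * k + 1) / (2 * k + 2) * (Real.pi / 2) * (2 * k + 1) : ℝ) =
        Real.pi * ((2 * k + 1) ^ 2 / (4 * (k + 1))) := by
      field_simp
      ring
    rw [h3]
    refine mul_le_mul_of_nonneg_left ?_ Real.pi_pos.le
    rw [le_div_iff₀ (by positivity)]
    nlinarith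
  exact h2.trans (mul_le_mul_of_nonneg_right h1 (by positivity))

theorem le_two_mul_sqrt_pi_mul {k : ℕ} (hk : 1 ≤ k) :
    4 ^ k / (k.centralBinom : ℝ) ≤ 2 * √(Real.pi * k) := by
  have h2 : (0 : ℝ) ≤ 2 * √(Real.pi * k) := by positivity
  refine le_of_sq_le_sq ?_ h2
  rw [sq_div_centralBinom, mul_pow, Real.sq_sqrt (by positivity)]
  have h1 := Real.Wallis.W_le k
  have hk' : (1 : ℝ) ≤ k := by exact_mod_cast hk
  nlinarith [Real.pi_pos]

theorem alphaFD_le {k : ℕ} (hk : 1 ≤ k) :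
    alphaFD k ≤ 1 / (((k : ℝ) + 1) * √(Real.pi * k)) := by
  have hk' : (0 : ℝ) < k := by exact_mod_cast hk
  have h1 : 0 < √(Real.pi * k) := Real.sqrt_pos.2 (by positivity)
  have h3 : (0 : ℝ) < k.centralBinom := by exact_mod_cast k.centralBinom_pos
  have h2 := sqrt_pi_mul_le k
  rw [le_div_iff₀ h3] at h2
  rw [alphaFD_eq, div_le_div_iff₀ (by positivity) (by positivity)]
  nlinarith

/-- Serves only for the summability of the series in `tailFD`, without which its `tsum` would be `0`
by default; hence the crude constant. At `k = 0` the left-hand side is `0`, as a division by zero.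
-/
theorem le_two_mul_alphaFD (k : ℕ) :
    1 / (((k : ℝ) + 1) * √(Real.pi * k)) ≤ 2 * alphaFD k := by
  rcases Nat.eq_zero_or_pos k with rfl | hk
  · have := alphaFD_pos 0
    simp only [Nat.cast_zero, mul_zero, Real.sqrt_zero, div_zero]
    positivity
  have hk' : (0 : ℝ) < k := by exact_mod_cast hk
  have h1 : 0 < √(Real.pi * k) := Real.sqrt_pos.2 (by positivity)
  have h3 : (0 : ℝ) < k.centralBinom := by exact_mod_cast k.centralBinom_pos
  have h2 := le_two_mul_sqrt_pi_mul hk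
  rw [div_le_iff₀ h3] at h2
  rw [alphaFD_eq, ← mul_div_assoc, div_le_div_iff₀ (by positivity) (by positivity)]
  nlinarith

theorem tsum_alphaFD_le_tailFD {m : ℕ} (hm : 1 ≤ m) :
    ∑' k, alphaFD (k + m) ≤ tailFD m := by
  have hs : Summable fun k : ℕ => 1 / (((k : ℝ) + 1) * √(Real.pi * k)) :=
    Summable.of_nonneg_of_le (fun k => by positivity) le_two_mul_alphaFD
      (summable_alphaFD.mul_left 2)
  have hs' := (summable_nat_add_iff m).2 hs
  unfold tailFD
  simp only [add_comm m]
  exact ((summable_nat_add_iff m).2 summable_alphaFD).tsum_le_tsum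
    (fun k => alphaFD_le (by lia)) hs'

variable {r : ℝ}

theorem summable_pow_mul_alphaFD (h0 : 0 ≤ r) (h1 : r ≤ 1) :
    Summable fun j => r ^ j * alphaFD j :=
  Summable.of_nonneg_of_le (fun j => mul_nonneg (pow_nonneg h0 j) (alphaFD_pos j).le)
    (fun j => mul_le_of_le_one_left (alphaFD_pos j).le (pow_le_one₀ h0 h1)) summable_alphaFD

/-- The tail of the majorant series. -/
noncomputable def majorantTail (r : ℝ) (m : ℕ) : ℝ := ∑' j, r ^ (j + m) * alphaFD (j + m)

theorem majorantTail_le_geometric (h0 : 0 ≤ r) (h1 : r < 1) (m : ℕ) :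
    majorantTail r m ≤ r ^ m / (1 - r) * alphaFD m := by
  have hg := (hasSum_geometric_of_lt_one h0 h1).mul_left (r ^ m * alphaFD m)
  have hle := ((summable_nat_add_iff m).2 (summable_pow_mul_alphaFD h0 h1.le)).tsum_le_tsum
    (fun j => ?_) hg.summable
  · rw [hg.tsum_eq] at hle
    refine hle.trans_eq ?_
    field_simp
  · rw [pow_add]
    have := alphaFD_antitone (show m ≤ j + m by lia)
    have h2 : 0 ≤ r ^ j * r ^ m := by positivity
    nlinarith

/-- The source of superexponential convergence: beside `r ^ m` stands the tail of a convergent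
series, which tends to `0` even if `r = 1`. -/
theorem majorantTail_le (h0 : 0 ≤ r) (h1 : r ≤ 1) (m : ℕ) :
    majorantTail r m ≤ r ^ m * ∑' j, alphaFD (j + m) := by
  rw [← tsum_mul_left]
  refine ((summable_nat_add_iff m).2 (summable_pow_mul_alphaFD h0 h1)).tsum_le_tsum
    (fun j => ?_) (((summable_nat_add_iff m).2 summable_alphaFD).mul_left _)
  refine mul_le_mul_of_nonneg_right ?_ (alphaFD_pos _).le
  exact pow_le_pow_of_le_one h0 h1 (by lia)

/-- Two offsets are needed because the eigenvalue correction of index `j + 1` is controlled by the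
majorant of index `j`. -/
theorem norm_sub_sum_le_majorantTail {E : Type*} [NormedAddCommGroup E] {f : ℕ → E} {s : E}
    (hf : HasSum f s) {c : ℝ} {k : ℕ} (h0 : 0 ≤ r) (h1 : r ≤ 1) {m : ℕ}
    (hb : ∀ j, ‖f (j + k)‖ ≤ c * (r ^ (j + m) * alphaFD (j + m))) :
    ‖s - ∑ j ∈ Finset.range k, f j‖ ≤ c * majorantTail r m := by
  have h2 := (hasSum_nat_add_iff' k).2 hf
  exact h2.norm_le_of_bounded
    ((((summable_nat_add_iff m).2 (summable_pow_mul_alphaFD h0 h1)).hasSum).mul_left c) hb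

theorem isLittleO_of_le_majorantTail {a : ℕ → ℝ} {c : ℝ} (h0 : 0 ≤ r) (h1 : r ≤ 1)
    (hc : 0 ≤ c) (h : ∀ m, |a m| ≤ c * majorantTail r m) : a =o[atTop] fun m => r ^ m := by
  have ht : Tendsto (fun m => c * ∑' j, alphaFD (j + m)) atTop (𝓝 0) := by
    simpa using (tendsto_sum_nat_add alphaFD).const_mul c
  rw [isLittleO_iff]
  intro δ hδ
  filter_upwards [ht.eventually_le_const hδ] with m hm
  have h2 : 0 ≤ r ^ m := pow_nonneg h0 m
  rw [Real.norm_eq_abs, Real.norm_of_nonneg h2]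
  calc |a m| ≤ c * (r ^ m * ∑' j, alphaFD (j + m)) :=
        (h m).trans (mul_le_mul_of_nonneg_left (majorantTail_le h0 h1 m) hc)
    _ = (c * ∑' j, alphaFD (j + m)) * r ^ m := by ring
    _ ≤ δ * r ^ m := mul_le_mul_of_nonneg_right hm h2

theorem majorantTail_succ_le (h0 : 0 ≤ r) (h1 : r ≤ 1) (m : ℕ) :
    majorantTail r (m + 1) ≤ majorantTail r m := by
  have hs := (summable_nat_add_iff m).2 (summable_pow_mul_alphaFD h0 h1)
  have h2 := hs.tsum_eq_zero_add
  have h3 : ∑' j, r ^ (j + 1 + m) * alphaFD (j + 1 + m) = majorantTail r (m + 1) :=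
    tsum_congr fun j => by rw [show j + 1 + m = j + (m + 1) by lia]
  rw [h3] at h2
  have h4 : 0 ≤ r ^ (0 + m) * alphaFD (0 + m) :=
    mul_nonneg (pow_nonneg h0 _) (alphaFD_pos _).le
  unfold majorantTail at *
  linarith

end Tails

/-! ### Boundedness and continuity of the two potentials -/

section Mesh

variable {q qbar : ℝ → ℝ} {N : ℕ} {x : Fin (N + 1) → ℝ}

theorem PiecewiseContinuous.exists_bound (hq : PiecewiseContinuous q) :
    ∃ C, ∀ y ∈ Icc (-1 : ℝ) 1, |q y| ≤ C := by
  -- By compactness a local bound suffices; near `a` it comes from the two one-sided limits and the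
  -- value at `a`.
  refine isCompact_Icc.induction_on (p := fun s => ∃ C, ∀ y ∈ s, |q y| ≤ C) ⟨0, by simp⟩
    (fun s t hst ⟨C, hC⟩ => ⟨C, fun y hy => hC y (hst hy)⟩)
    (fun s t ⟨C, hC⟩ ⟨C', hC'⟩ => ⟨max C C', fun y hy => hy.elim
      (fun h => (hC y h).trans (le_max_left _ _)) fun h => (hC' y h).trans (le_max_right _ _)⟩)
    fun a ha => ?_
  have hbound : ∀ {F : Filter ℝ} {l : ℝ}, Tendsto q F (𝓝 l) → ∃ C, ∀ᶠ y in F, |q y| ≤ C :=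
    fun {F l} h => ⟨|l| + 1, (h.abs.eventually_le_const (lt_add_one _))⟩
  obtain ⟨C₁, h₁⟩ : ∃ C, ∀ᶠ y in 𝓝[>] a, y ≤ 1 → |q y| ≤ C := by
    rcases ha.2.eq_or_lt with rfl | h
    · refine ⟨0, ?_⟩
      filter_upwards [self_mem_nhdsWithin] with y hy h
      exact absurd h (not_le.2 hy)
    · obtain ⟨l, hl⟩ := hq.2.1 a ⟨ha.1, h⟩
      obtain ⟨C, hC⟩ := hbound hl
      exact ⟨C, hC.mono fun y hy _ => hy⟩
  obtain ⟨C₂, h₂⟩ : ∃ C, ∀ᶠ y in 𝓝[<] a, -1 ≤ y → |q y| ≤ C := by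
    rcases ha.1.eq_or_lt with rfl | h
    · refine ⟨0, ?_⟩
      filter_upwards [self_mem_nhdsWithin] with y hy h
      exact absurd h (not_le.2 hy)
    · obtain ⟨l, hl⟩ := hq.2.2 a ⟨h, ha.2⟩
      obtain ⟨C, hC⟩ := hbound hl
      exact ⟨C, hC.mono fun y hy _ => hy⟩
  rw [eventually_nhdsWithin_iff] at h₁ h₂
  have h₃ : ∀ᶠ y in 𝓝[Icc (-1) 1] a, |q y| ≤ max (max C₁ C₂) |q a| := by
    rw [eventually_nhdsWithin_iff]
    filter_upwards [h₁, h₂] with y hy1 hy2 hy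
    rcases lt_trichotomy y a with h | rfl | h
    · exact (hy2 h hy.1).trans ((le_max_right _ _).trans (le_max_left _ _))
    · exact le_max_right _ _
    · exact (hy1 h hy.2).trans ((le_max_left _ _).trans (le_max_left _ _))
  exact ⟨_, h₃, _, fun y hy => hy⟩

theorem IsMesh.exists_mem_cell (hx : IsMesh x) {y : ℝ} (hy : y ∈ Icc (-1 : ℝ) 1)
    (hyx : y ∉ range x) : ∃ i : Fin N, y ∈ Ioo (x i.castSucc) (x i.succ) := by
  by_contra! h
  have hlt : ∀ j, x j < y := by
    intro j
    induction j using Fin.induction with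
    | zero => exact lt_of_le_of_ne (hx.first ▸ hy.1) fun h => hyx ⟨0, h⟩
    | succ i ih =>
      by_contra! h2
      exact h i ⟨ih, lt_of_le_of_ne h2 fun h => hyx ⟨i.succ, h.symm⟩⟩
  have := hlt (Fin.last N)
  rw [hx.last] at this
  exact absurd hy.2 (not_le.2 this)

theorem IsPiecewiseConstant.exists_bound (hx : IsMesh x) (hqbar : IsPiecewiseConstant x qbar) :
    ∃ C, ∀ y ∈ Icc (-1 : ℝ) 1, |qbar y| ≤ C := by
  choose c hc using hqbar
  have hfin : ((fun y => |qbar y|) '' Icc (-1 : ℝ) 1).Finite := by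
    refine (((finite_range x).image fun y => |qbar y|).union
      (finite_range fun i => |c i|)).subset ?_
    rintro _ ⟨y, hy, rfl⟩
    by_cases hyx : y ∈ range x
    · exact Or.inl ⟨y, hyx, rfl⟩
    · obtain ⟨i, hi⟩ := hx.exists_mem_cell hy hyx
      exact Or.inr ⟨i, by simp [hc i y hi]⟩
  obtain ⟨C, hC⟩ := hfin.bddAbove
  exact ⟨C, fun y hy => hC ⟨y, hy, rfl⟩⟩

theorem IsPiecewiseConstant.isPotential (hx : IsMesh x) (hqbar : IsPiecewiseConstant x qbar) :
    IsPotential (range x) qbar where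
  finite := finite_range x
  bounded := by
    obtain ⟨C, hC⟩ := hqbar.exists_bound hx
    exact ⟨C, fun y hy => hC y (Ioo_subset_Icc_self hy)⟩
  continuousAt y hy hyx := by
    obtain ⟨i, hi⟩ := hx.exists_mem_cell (Ioo_subset_Icc_self hy) hyx
    obtain ⟨c, hc⟩ := hqbar i
    refine (continuousAt_const (y := c)).congr ?_
    filter_upwards [isOpen_Ioo.mem_nhds hi] with z hz using (hc z hz).symm

theorem PiecewiseContinuous.isPotential (hq : PiecewiseContinuous q)
    (hdisc : ∀ y ∈ Icc (-1 : ℝ) 1, ¬ ContinuousWithinAt q (Icc (-1 : ℝ) 1) y → y ∈ range x) :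
    IsPotential (range x) q where
  finite := finite_range x
  bounded := by
    obtain ⟨C, hC⟩ := hq.exists_bound
    exact ⟨C, fun y hy => hC y (Ioo_subset_Icc_self hy)⟩
  continuousAt y hy hyx := by
    by_contra h
    refine hyx (hdisc y (Ioo_subset_Icc_self hy) fun hc => h ?_)
    exact hc.continuousAt (Icc_mem_nhds hy.1 hy.2)

theorem supNorm_nonneg (f : ℝ → ℝ) : 0 ≤ supNorm f :=
  Real.sSup_nonneg (by rintro _ ⟨y, _, rfl⟩; exact abs_nonneg _)

theorem abs_le_supNorm {f : ℝ → ℝ} {C : ℝ} (hC : ∀ y ∈ Icc (-1 : ℝ) 1, |f y| ≤ C) {y : ℝ}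
    (hy : y ∈ Icc (-1 : ℝ) 1) : |f y| ≤ supNorm f :=
  le_csSup ⟨C, by rintro _ ⟨z, hz, rfl⟩; exact hC z hz⟩ ⟨y, hy, rfl⟩

end Mesh

/-! ### Passage between functions and their classes in `L²(-1, 1)` -/

namespace L2Unit

variable {X : Set ℝ} {p q qbar u v : ℝ → ℝ} {T D : L2Unit →L[ℝ] L2Unit} {f g : L2Unit}

theorem inner_eq_integral (hf : f =ᵐ[unitMeasure] u) (hg : g =ᵐ[unitMeasure] v) :
    ⟪f, g⟫_ℝ = ∫ x in (-1 : ℝ)..1, u x * v x := by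
  rw [← integral_unitMeasure, L2.inner_def]
  refine integral_congr_ae ?_
  filter_upwards [hf, hg] with x h1 h2
  rw [h1, h2]
  simp only [RCLike.inner_apply, conj_trivial]
  ring

theorem norm_eq_l2Norm (hf : f =ᵐ[unitMeasure] u) : ‖f‖ = l2Norm u := by
  rw [l2Norm]
  simp only [sq]
  rw [← inner_eq_integral hf hf, real_inner_self_eq_norm_mul_norm,
    Real.sqrt_mul_self (norm_nonneg f)]

theorem zero_ae_neg_zero : ((0 : L2Unit) : ℝ → ℝ) =ᵐ[unitMeasure] fun x => -(fun _ : ℝ => (0 : ℝ)) x := by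
  filter_upwards [Lp.coeFn_zero ℝ 2 unitMeasure] with x hx
  rw [hx]; simp

theorem exists_isEigenfunction (hT : IsMulOp T p) (hp : IsPotential X p) {l : ℝ}
    (hf : ResolventEq green (T - meanCLM) l 0 f) (h0 : f ≠ 0) :
    ∃ u, f =ᵐ[unitMeasure] u ∧ IsEigenfunction X p l u := by
  obtain ⟨hfu, hu⟩ := solvesBVP_of_resolventEq hT hp (fun _ _ _ => continuousAt_const)
    zero_ae_neg_zero hf
  refine ⟨_, hfu, hu, ?_⟩
  by_contra! h
  refine h0 (Lp.ext ?_)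
  filter_upwards [hfu, Lp.coeFn_zero ℝ 2 unitMeasure, ae_mem_Ioo] with x h1 h2 hx
  rw [h1, h2, h x hx, Pi.zero_apply]

theorem resolventEq_of_isEigenfunction (hT : IsMulOp T p) (hp : IsPotential X p) {l : ℝ}
    (hu : IsEigenfunction X p l u) (hf : f =ᵐ[unitMeasure] u) :
    ResolventEq green (T - meanCLM) l 0 f ∧ f ≠ 0 := by
  refine ⟨resolventEq_of_solvesBVP hT hp.finite hu.1 zero_ae_neg_zero hf, ?_⟩
  rintro rfl
  obtain ⟨x, hx, hux⟩ := hu.2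
  have h : u =ᵐ[unitMeasure] fun _ => 0 := by
    filter_upwards [hf, Lp.coeFn_zero ℝ 2 unitMeasure] with y h1 h2
    rw [← h1, h2, Pi.zero_apply]
  exact hux (Measure.eqOn_open_of_ae_eq h isOpen_Ioo hu.1.continuousOn continuousOn_const hx)

theorem IsMulOp.sub_meanCLM_symm (hT : IsMulOp T p) (f g : L2Unit) :
    ⟪(T - meanCLM) f, g⟫_ℝ = ⟪f, (T - meanCLM) g⟫_ℝ := by
  simp only [sub_apply, inner_sub_left, inner_sub_right]
  rw [hT.symm, meanCLM_symm]

theorem exists_isEigenbasis (hT : IsMulOp T p) (hp : IsPotential X p) :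
    ∃ (lam : ℕ → ℝ) (b : HilbertBasis ℕ ℝ L2Unit),
      IsEigenbasis green (T - meanCLM) lam b ∧ IsEigenvalueSeq X p lam := by
  obtain ⟨lam, b, hmono, hb⟩ := exists_hilbertBasis_eigenvectors isCompactPositive_green
    hT.sub_meanCLM_symm not_finiteDimensional
    (fun l u w hu hw hw0 => eq_smul_of_resolventEq hT hp hu hw hw0)
  have hE : IsEigenbasis green (T - meanCLM) lam b :=
    ⟨isCompactPositive_green.symm, hT.sub_meanCLM_symm, hmono, hb⟩
  refine ⟨lam, b, hE, hmono, ?_⟩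
  ext l
  constructor
  · rintro ⟨k, rfl⟩
    obtain ⟨u, -, hu⟩ := exists_isEigenfunction hT hp (hb k) (by
      rw [← norm_ne_zero_iff, b.orthonormal.1]; exact one_ne_zero)
    exact ⟨u, hu⟩
  · rintro ⟨u, hu⟩
    obtain ⟨h1, h2⟩ := resolventEq_of_isEigenfunction hT hp hu hu.1.memLp.coeFn_toLp
    exact hE.mem_range h1 h2

theorem sum_smul_ae {f : ℕ → L2Unit} {v : ℕ → ℝ → ℝ} (hf : ∀ j, f j =ᵐ[unitMeasure] v j)
    (c : ℕ → ℝ) (s : Finset ℕ) :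
    (∑ i ∈ s, c i • f i : L2Unit) =ᵐ[unitMeasure] fun x => ∑ i ∈ s, c i * v i x := by
  induction s using Finset.induction_on with
  | empty =>
    filter_upwards [Lp.coeFn_zero ℝ 2 unitMeasure] with x hx
    simpa using hx
  | insert a s ha ih =>
    rw [Finset.sum_insert ha]
    filter_upwards [ih, hf a, Lp.coeFn_smul (c a) (f a),
      Lp.coeFn_add (c a • f a) (∑ i ∈ s, c i • f i)] with x h1 h2 h3 h4
    rw [h4, Pi.add_apply, h1, h3, Pi.smul_apply, h2, Finset.sum_insert ha, smul_eq_mul]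

theorem fdSource_ae (hD : IsMulOp D fun x => q x - qbar x) {mu : ℕ → ℝ} {f : ℕ → L2Unit}
    {v : ℕ → ℝ → ℝ} (hf : ∀ j, f j =ᵐ[unitMeasure] v j) (j : ℕ) :
    (fdSource D mu f j : L2Unit) =ᵐ[unitMeasure] fun x => -fdRhs q qbar mu v j x := by
  cases j with
  | zero => exact zero_ae_neg_zero
  | succ j =>
    rw [fdSource]
    filter_upwards [Lp.coeFn_sub (∑ s ∈ Finset.range (j + 1), mu (j + 1 - s) • f s) (D (f j)),
      sum_smul_ae hf (fun s => mu (j + 1 - s)) (Finset.range (j + 1)), hD (f j), hf j]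
      with x h1 h2 h3 h4
    rw [h1, Pi.sub_apply, h2, h3, h4, fdRhs]
    ring

/-- The corrections of the FD-method form a perturbation series in `L²(-1, 1)`. -/
theorem isFDSequence_of_isFDSeries (hT : IsMulOp T qbar) (hX : X.Finite)
    (hD : IsMulOp D fun x => q x - qbar x) {mu : ℕ → ℝ} {v : ℕ → ℝ → ℝ}
    (h : IsFDSeries X q qbar mu v) {f : ℕ → L2Unit} (hf : ∀ j, f j =ᵐ[unitMeasure] v j) :
    IsFDSequence green (T - meanCLM) D mu f where
  solves j := resolventEq_of_solvesBVP hT hX (h.solves j) (fdSource_ae hD hf j) (hf j)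
  orthogonal j := (inner_eq_integral (hf j) (hf 0)).trans (h.orthogonal j)

/-- Conversely, a perturbation series in `L²(-1, 1)` comes from corrections of the FD-method. -/
theorem exists_isFDSeries (hT : IsMulOp T qbar) (hq : IsPotential X q)
    (hqbar : IsPotential X qbar) (hD : IsMulOp D fun x => q x - qbar x) {mu : ℕ → ℝ}
    {f : ℕ → L2Unit} (h : IsFDSequence green (T - meanCLM) D mu f) :
    ∃ v, IsFDSeries X q qbar mu v := by
  set v : ℕ → ℝ → ℝ := fun j =>
    greenRep (mu 0 • f j - (T - meanCLM) (f j) + fdSource D mu f j) with hv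
  have hf : ∀ j, f j =ᵐ[unitMeasure] v j := fun j => by
    have h1 := green_ae (mu 0 • f j - (T - meanCLM) (f j) + fdSource D mu f j)
    rwa [show green _ = f j from h.solves j] at h1
  have hvc : ∀ j, ∀ x ∈ Ioo (-1 : ℝ) 1, ContinuousAt (v j) x := fun j x hx =>
    (hasDerivAt_greenRep _ hx).continuousAt
  have hFc : ∀ j, ∀ x ∈ Ioo (-1 : ℝ) 1, x ∉ X → ContinuousAt (fdRhs q qbar mu v j) x := by
    intro j x hx hxX
    cases j with
    | zero => exact continuousAt_const
    | succ j =>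
      have h1 : ContinuousAt (fun x => ∑ s ∈ Finset.range (j + 1), mu (j + 1 - s) * v s x) x :=
        tendsto_finsetSum _ fun s _ => continuousAt_const.mul (hvc s x hx)
      exact h1.neg.add (((hq.continuousAt x hx hxX).sub (hqbar.continuousAt x hx hxX)).mul
        (hvc j x hx))
  exact ⟨v, fun j => (solvesBVP_of_resolventEq hT hqbar (hFc j) (fdSource_ae hD hf j)
    (h.solves j)).2, fun j => (inner_eq_integral (hf j) (hf 0)).symm.trans (h.orthogonal j)⟩

end L2Unit

namespace L2Unit

theorem norm_sub_sum_eq_l2Norm {U : L2Unit} {f : ℕ → L2Unit} {u : ℝ → ℝ} {v : ℕ → ℝ → ℝ}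
    (hU : U =ᵐ[unitMeasure] u) (hf : ∀ j, f j =ᵐ[unitMeasure] v j) (m : ℕ) :
    ‖U - ∑ j ∈ Finset.range m, f j‖ = l2Norm fun y => u y - ∑ j ∈ Finset.range m, v j y := by
  refine norm_eq_l2Norm ?_
  have h := sum_smul_ae hf (fun _ => 1) (Finset.range m)
  simp only [one_smul, one_mul] at h
  filter_upwards [h, hU, Lp.coeFn_sub U (∑ j ∈ Finset.range m, f j)] with y h1 h2 h3
  rw [h3, Pi.sub_apply, h1, h2]

end L2Unit

/-! ### Convergence of the FD-method -/

open L2Unit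

theorem theorem2 (q qbar : ℝ → ℝ) (N : ℕ) (x : Fin (N + 1) → ℝ)
    (hx : IsMesh x) (hq : PiecewiseContinuous q)
    (hdisc : ∀ y ∈ Icc (-1 : ℝ) 1, ¬ ContinuousWithinAt q (Icc (-1 : ℝ) 1) y → y ∈ range x)
    (hqbar : IsPiecewiseConstant x qbar) :
    ∃ lam0 lam : ℕ → ℝ,
      IsEigenvalueSeq (range x) qbar lam0 ∧ IsEigenvalueSeq (range x) q lam ∧
      ∀ (n : ℕ) (eps rbar r : ℝ),
        eps = supNorm (fun y => q y - qbar y) → rbar = invGap lam0 n * eps → r = 4 * rbar →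
        rbar ≤ 1 / 4 →
        (∃ (mu : ℕ → ℝ) (v : ℕ → ℝ → ℝ), mu 0 = lam0 n ∧ IsFDSeries (range x) q qbar mu v) ∧
        ∀ (mu : ℕ → ℝ) (v : ℕ → ℝ → ℝ), mu 0 = lam0 n → IsFDSeries (range x) q qbar mu v →
          (∃ u : ℝ → ℝ, IsEigenfunction (range x) q (lam n) u ∧
            ∫ y in (-1 : ℝ)..1, u y * v 0 y = 1) ∧
          ∀ u : ℝ → ℝ, IsEigenfunction (range x) q (lam n) u →
            ∫ y in (-1 : ℝ)..1, u y * v 0 y = 1 →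
            -- superexponential convergence
            (fun m : ℕ => l2Norm (fun y => u y - ∑ j ∈ Finset.range (m + 1), v j y))
              =o[atTop] (fun m : ℕ => r ^ m) ∧
            (fun m : ℕ => lam n - ∑ j ∈ Finset.range (m + 1), mu j)
              =o[atTop] (fun m : ℕ => r ^ m) ∧
            -- explicit bounds for `r < 1`
            (r < 1 → ∀ m : ℕ,
              l2Norm (fun y => u y - ∑ j ∈ Finset.range (m + 1), v j y)
                ≤ r ^ (m + 1) / (1 - r) * alphaFD (m + 1) ∧
              |lam n - ∑ j ∈ Finset.range (m + 1), mu j|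
                ≤ eps * (r ^ m / (1 - r)) * alphaFD m) ∧
            -- explicit bounds for `r = 1`
            (r = 1 →
              (∀ m : ℕ, l2Norm (fun y => u y - ∑ j ∈ Finset.range (m + 1), v j y)
                ≤ tailFD (m + 1)) ∧
              (∀ m : ℕ, 1 ≤ m →
                |lam n - ∑ j ∈ Finset.range (m + 1), mu j| ≤ eps * tailFD m)) := by
  have hpq := hq.isPotential hdisc
  have hpb := hqbar.isPotential hx
  obtain ⟨Tq, hTq⟩ := hpq.exists_isMulOp
  obtain ⟨Tb, hTb⟩ := hpb.exists_isMulOp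
  obtain ⟨lam0, b0, hE0, hS0⟩ := exists_isEigenbasis hTb hpb
  obtain ⟨lam, b, hE, hS⟩ := exists_isEigenbasis hTq hpq
  have hD : IsMulOp (Tq - Tb) fun y => q y - qbar y := hTq.sub hTb
  have hE' : IsEigenbasis green (Tb - meanCLM + (Tq - Tb)) lam b := by
    rwa [show Tb - meanCLM + (Tq - Tb) = Tq - meanCLM by abel]
  refine ⟨lam0, lam, hS0, hS, ?_⟩
  rintro n eps rbar r heps rfl rfl hsmall
  have heps0 : 0 ≤ eps := heps ▸ supNorm_nonneg _
  have hDle : ∀ f, ‖(Tq - Tb) f‖ ≤ eps * ‖f‖ := by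
    obtain ⟨C, hC⟩ := hq.exists_bound
    obtain ⟨C', hC'⟩ := hqbar.exists_bound hx
    rw [heps]
    exact hD.norm_le fun y hy => abs_le_supNorm (f := fun y => q y - qbar y)
      (fun z hz => (abs_sub _ _).trans (add_le_add (hC z hz) (hC' z hz)))
      (Ioo_subset_Icc_self hy)
  refine ⟨?_, fun mu v hmu hv => ?_⟩
  · obtain ⟨mu, f, hmu, hf⟩ := hE0.exists_isFDSequence isCompactOperator_green (Tq - Tb) n
    obtain ⟨v, hv⟩ := exists_isFDSeries hTb hpq hpb hD hf
    exact ⟨mu, v, hmu, hv⟩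
  let f : ℕ → L2Unit := fun j => ((hv.solves j).memLp).toLp
  have hfv : ∀ j, f j =ᵐ[unitMeasure] v j := fun j => (hv.solves j).memLp.coeFn_toLp
  have hf := isFDSequence_of_isFDSeries hTb hpb.finite hD hv hfv
  obtain ⟨U, hsum, hmusum, hU, hU1⟩ := hf.exists_hasSum hE0 hE' hmu heps0 hDle hsmall
  rw [show Tb - meanCLM + (Tq - Tb) = Tq - meanCLM by abel] at hU
  constructor
  · obtain ⟨u, hUu, hu⟩ := exists_isEigenfunction hTq hpq hU (by rintro rfl; simp at hU1)
    exact ⟨u, hu, (inner_eq_integral hUu (hfv 0)).symm.trans hU1⟩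
  intro u hu hu1
  -- Both are multiples of `b n` by simplicity, and the normalization against `v 0` makes the
  -- factors equal.
  have hUu : U =ᵐ[unitMeasure] u := by
    have hW := hu.1.memLp.coeFn_toLp
    have h1 := hE.eq_smul (resolventEq_of_isEigenfunction hTq hpq hu hW).1
    have h2 := hE.eq_smul hU
    have h3 := (inner_eq_integral hW (hfv 0)).trans hu1
    set W := hu.1.memLp.toLp
    set a := ⟪W, b n⟫_ℝ
    set c := ⟪U, b n⟫_ℝ
    rw [h1, inner_smul_left, RCLike.conj_to_real] at h3
    rw [h2, inner_smul_left, RCLike.conj_to_real] at hU1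
    have h4 : a = c := mul_right_cancel₀ (right_ne_zero_of_mul_eq_one h3) (h3.trans hU1.symm)
    rw [h2, ← h4, ← h1]
    exact hW
  have hM := invGap_pos hE0.strictMono n
  set r : ℝ := 4 * (invGap lam0 n * eps) with hr
  have hr0 : 0 ≤ r := by positivity
  have hr1 : r ≤ 1 := by linarith
  have hfun : ∀ m, l2Norm (fun y => u y - ∑ j ∈ Finset.range (m + 1), v j y)
      ≤ majorantTail r (m + 1) := fun m => by
    rw [← norm_sub_sum_eq_l2Norm hUu hfv, ← one_mul (majorantTail r (m + 1))]
    refine norm_sub_sum_le_majorantTail hsum hr0 hr1 fun j => ?_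
    rw [one_mul]
    exact hf.norm_le_alphaFD hE0 hmu heps0 hDle _
  -- The remainder starts at `mu (m + 1)`, whose majorant has index `m`; this is why the eigenvalue
  -- bound lags one power of `r` behind the eigenfunction bound.
  have hval : ∀ m, |lam n - ∑ j ∈ Finset.range (m + 1), mu j| ≤ eps * majorantTail r m :=
    fun m => norm_sub_sum_le_majorantTail hmusum hr0 hr1 fun j =>
      hf.abs_mu_succ_le_alphaFD hE0 hmu heps0 hDle (j + m)
  refine ⟨?_, isLittleO_of_le_majorantTail hr0 hr1 heps0 hval, fun hlt m => ⟨?_, ?_⟩,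
    fun hone => ⟨fun m => ?_, fun m hm => ?_⟩⟩
  · refine isLittleO_of_le_majorantTail hr0 hr1 zero_le_one fun m => ?_
    rw [l2Norm, abs_of_nonneg (Real.sqrt_nonneg _), one_mul]
    exact (hfun m).trans (majorantTail_succ_le hr0 hr1 m)
  · exact (hfun m).trans (majorantTail_le_geometric hr0 hlt _)
  · rw [mul_assoc]
    exact (hval m).trans (mul_le_mul_of_nonneg_left (majorantTail_le_geometric hr0 hlt m) heps0)
  · refine (hfun m).trans ((majorantTail_le hr0 hr1 _).trans ?_)
    rw [hone, one_pow, one_mul]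
    exact tsum_alphaFD_le_tailFD m.succ_pos
  · refine (hval m).trans (mul_le_mul_of_nonneg_left ((majorantTail_le hr0 hr1 _).trans ?_) heps0)
    rw [hone, one_pow, one_mul]
    exact tsum_alphaFD_le_tailFD hm
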